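/- Let $\Bbbk$ be a field of characteristic zero and let $n\ge 6$ be an integer. Put $a=(n-1)n/2$, $q=2\lfloor (n+1)/2\rfloor-1$, $s_0=a(n-1)+2$, and let $\mathcal S=\langle a,a+1,a+2\rangle\subset\mathbb N$ be the numerical semigroup generated by $a,a+1,a+2$. Let $\rho:\Bbbk[[x,y,z]]\to\Bbbk[[t]]$ be the $\Bbbk$-algebra homomorphism of substitution with $\rho(x)=t^a(1+t^q)$, $\rho(y)=t^{a+1}$, $\rho(z)=t^{a+2}$. For $r\in\mathcal S$, let $W_r$ be the $\Bbbk$-vector space spanned by the monomials $x^{\alpha_1}y^{\alpha_2}z^{\alpha_3}$ with $\alpha_1a+\alpha_2(a+1)+\alpha_3(a+2)=r$. Write $r=a\ell_r+\varepsilon_r$ with $0\le\varepsilon_r<a$, and put $\phi_{r,1}=\ell_r-\lfloor(\varepsilon_r+1)/2\rfloor$, which is a non-negative integer. An integer $k\in[0,\phi_{r,1}]$ is called $r$-good if $r+kq\ne s+jq$ for all $s\in\mathcal S$ with $s>r$ and all $j\in[0,\phi_{s,1}]$; let $G_r$ be the set of $r$-good integers. Let $\rho_r^{G_r}:W_r\to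 T_r^{G_r}=\langle t^{r+kq}\mid k\in G_r\rangle_{\Bbbk}$ be the linear map given by $\rho$ on $W_r$ followed by the projection which keeps the terms in $t^{r+kq}$ with $k\in G_r$ and deletes all the others. For finite sets $I,J\subset\mathbb N$ of the same cardinality, let $b^I_J$ be the determinant of the matrix of binomial coefficients $\binom ij$ with rows $i\in I$ and columns $j\in J$ in increasing order. Intervals $[u,v]$ are intervals of integers, empty if $u>v$. Define polynomials $g_1,\dots,g_n\in\Bbbk[x,y,z]$ as follows. If $n$ is odd: - for $1\le k\le n-4$, $k$ odd, $$g_k=\sum_{j=0}^{\frac{k+1}2}(-1)^j\,b^{[n-k-2,\frac{2n-k-3}2]\setminus\{\frac{2n-k-3-2j}2\}}_{\{0\}\cup[\frac{n-k}2,\frac{n-3}2]}\;x^{\frac{2n-k-3-2j}2}y^{2j}z^{\frac{k+1-2j}2};$$ - for $2\le k\le n-3$, $k$ even, $$g_k=\sum_{j=0}^{\frac k2}(-1)^j\,b^{[n-k-2,\frac{2n-k-4}2]\setminus\{\frac{2n-k-4-2j}2\}}_{\{0\}\cup[\frac{n-k+1}2,\frac{n-3}2]}\;x^{\frac{2n-k-4-2j}2}y^{1+2j}z^{\frac{k-2j}2};$$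 - $$g_{n-2}=\sum_{j=0}^{\frac{n-1}2}(-1)^j\binom{\frac{n-1}2}{\frac{n-1-2j}2}x^{\frac{n-1-2j}2}y^{2j}z^{\frac{n-1-2j}2},$$ $$g_{n-1}=\sum_{j=0}^{\frac{n-3}2}(-1)^j\binom{\frac{n-3}2}{\frac{n-3-2j}2}x^{\frac{n-3-2j}2}y^{1+2j}z^{\frac{n-1-2j}2},$$ $$g_n=\sum_{j=0}^{\frac{n-3}2}(-1)^j\binom{\frac{n-3}2}{\frac{n-3-2j}2}x^{\frac{n-3-2j}2}y^{2j}z^{\frac{n+1-2j}2}.$$ If $n$ is even: - for $1\le k\le n-5$, $k$ odd, $$g_k=\sum_{j=0}^{\frac{k+1}2}(-1)^j\,b^{[n-k-2,\frac{2n-k-3}2]\setminus\{\frac{2n-k-3-2j}2\}}_{\{0\}\cup[\frac{n-k+1}2,\frac{n-2}2]}\;x^{\frac{2n-k-3-2j}2}y^{2j}z^{\frac{k+1-2j}2};$$ - for $2\le k\le n-4$, $k$ even, $$g_k=\sum_{j=0}^{\frac k2}(-1)^j\,b^{[n-k-2,\frac{2n-k-4}2]\setminus\{\frac{2n-k-4-2j}2\}}_{\{0\}\cup[\frac{n-k+2}2,\frac{n-2}2]}\;x^{\frac{2n-k-4-2j}2}y^{1+2j}z^{\frac{k-2j}2};$$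 - $$g_{n-3}=\sum_{j=0}^{\frac{n-2}2}(-1)^j\,b^{[1,\frac n2]\setminus\{\frac{n-2j}2\}}_{\{0\}\cup[2,\frac{n-2}2]}\;x^{\frac{n-2j}2}y^{2j}z^{\frac{n-2-2j}2},\qquad g_{n-2}=xy^{n-3}z-y^{n-1},$$ $$g_{n-1}=\sum_{j=0}^{\frac{n-2}2}(-1)^j\binom{\frac{n-2}2}{\frac{n-2-2j}2}x^{\frac{n-2-2j}2}y^{1+2j}z^{\frac{n-2-2j}2},$$ $$g_n=\sum_{j=0}^{\frac{n-2}2}(-1)^j\binom{\frac{n-2}2}{\frac{n-2-2j}2}x^{\frac{n-2-2j}2}y^{2j}z^{\frac{n-2j}2}.$$ Let $r_k=s_0+k-1$ for $1\le k\le n$. Then the following hold. (1) If $n$ is odd, then for each $1\le k\le n$ the space $\ker(\rho_{r_k}^{G_{r_k}})$ has dimension one and $g_k$ is a basis of it. (2) If $n$ is even, then - for each $1\le k\le n-3$, the space $\ker(\rho_{r_k}^{G_{r_k}})$ has dimension one and $g_k$ is a basis of it; - the space $\ker(\rho_{r_{n-2}}^{G_{r_{n-2}}})$ has dimension two and $g_{n-2},g_{n-1}$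 is a basis of it; - the space $\ker(\rho_{r_{n-1}}^{G_{r_{n-1}}})$ has dimension one and $g_n$ is a basis of it. -/

import Mathlib

noncomputable section

namespace GoodKernels

/-- The integer `a = (n-1)n/2` (the division is exact). -/
def a (n : ℕ) : ℕ := (n - 1) * n / 2

/-- The integer `q = 2⌊(n+1)/2⌋ - 1`. -/
def q (n : ℕ) : ℕ := 2 * ((n + 1) / 2) - 1

/-- The integer `s₀ = a(n-1) + 2`. -/
def s₀ (n : ℕ) : ℕ := a n * (n - 1) + 2

/-- The integers `r_k = s₀ + k - 1`, for `1 ≤ k ≤ n`. -/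
def r (n k : ℕ) : ℕ := s₀ n + k - 1

/-- The numerical semigroup `S = ⟨a, a+1, a+2⟩`. -/
def S (n : ℕ) : AddSubmonoid ℕ := AddSubmonoid.closure {a n, a n + 1, a n + 2}

/-- The set `F(r, S)` of factorizations of `r`. -/
def factorizations (n r : ℕ) : Set (Fin 3 →₀ ℕ) :=
  {α | α 0 * a n + α 1 * (a n + 1) + α 2 * (a n + 2) = r}

/-- The first coordinate `φ_{r,1} = ℓ_r - ⌊(ε_r + 1)/2⌋` of the distinguished factorization of `r`,
where `ℓ_r` and `ε_r` are the quotient and the remainder of the Euclidean division of `r` by `a`.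
For `r ∈ S` one has `ε_r ≤ 2 ℓ_r`, so that the subtraction does not truncate; only such `r` are
ever used. -/
def phi₁ (n r : ℕ) : ℕ := r / a n - (r % a n + 1) / 2

/-- `H_r = [0, φ_{r,1}]`. -/
def H (n r : ℕ) : Finset ℕ := Finset.Icc 0 (phi₁ n r)

/-- `k` is `r`-good if `r + kq ≠ s + jq` for all `s ∈ S` with `s > r` and all
`j ∈ [0, φ_{s,1}]`. -/
def IsGood (n r k : ℕ) : Prop :=
  ∀ s ∈ S n, r < s → ∀ j ∈ H n s, r + k * q n ≠ s + j * q n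

open Classical in
/-- The set `G_r` of `r`-good elements of `[0, φ_{r,1}]`. -/
def G (n r : ℕ) : Finset ℕ := (H n r).filter (IsGood n r)

lemma a_pos {n : ℕ} (hn : 3 ≤ n) : 0 < a n := by
  unfold a
  have : 2 * 3 ≤ (n - 1) * n := Nat.mul_le_mul (by omega) hn
  omega

lemma q_pos {n : ℕ} (hn : 3 ≤ n) : 0 < q n := by
  unfold q
  omega

variable (K : Type*) [Field K]

/-- The images of `x, y, z` under `ρ`. -/
def rhoVal (n : ℕ) : Fin 3 → PowerSeries K :=
  ![PowerSeries.X ^ a n * (1 + PowerSeries.X ^ q n),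
    PowerSeries.X ^ (a n + 1), PowerSeries.X ^ (a n + 2)]

lemma hasSubst_rhoVal {n : ℕ} (hn : 3 ≤ n) : MvPowerSeries.HasSubst (rhoVal K n) := by
  refine MvPowerSeries.hasSubst_of_constantCoeff_zero fun i => ?_
  change PowerSeries.constantCoeff (rhoVal K n i) = 0
  have := (a_pos hn).ne'
  fin_cases i <;> simp [rhoVal, this]

/-- The `K`-algebra homomorphism `ρ : K⟦x,y,z⟧ → K⟦t⟧` of substitution with
`ρ(x) = t^a (1 + t^q)`, `ρ(y) = t^(a+1)`, `ρ(z) = t^(a+2)`. -/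
def rho {n : ℕ} (hn : 3 ≤ n) : MvPowerSeries (Fin 3) K →ₐ[K] PowerSeries K :=
  MvPowerSeries.substAlgHom (hasSubst_rhoVal K hn)

/-- The space `W_r` of all power series in `K⟦x,y,z⟧` which are zero or homogeneous of degree `r`
for the grading in which `x, y, z` have degrees `a, a+1, a+2`. -/
def W (n r : ℕ) : Submodule K (MvPowerSeries (Fin 3) K) where
  carrier := {g | ∀ α, MvPowerSeries.coeff α g ≠ 0 → α ∈ factorizations n r}
  zero_mem' := by
    intro α h
    simp at h
  add_mem' := by
    intro f g hf hg α h
    by_cases h1 : MvPowerSeries.coeff α f = 0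
    · exact hg α fun h2 => h (by simp [h1, h2])
    · exact hf α h1
  smul_mem' := by
    intro c f hf α h
    exact hf α fun h1 => h (by simp [h1])

/-- The subspace `T_r^L` of `K⟦t⟧` spanned by the `t^(r+kq)` with `k ∈ L`. -/
def T (n r : ℕ) (L : Finset ℕ) : Submodule K (PowerSeries K) :=
  Submodule.span K ((fun k => (PowerSeries.X : PowerSeries K) ^ (r + k * q n)) '' L)

/-- The projection onto `T_r^L`, which keeps the terms in `t^(r+kq)` with `k ∈ L` and deletes
all others; on `T_r = T_r^{H_r}`, with `L ⊆ H_r`, it is the natural projection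
(see `proj_X_pow`). -/
def proj (n r : ℕ) (L : Finset ℕ) : PowerSeries K →ₗ[K] T K n r L :=
  LinearMap.codRestrict (T K n r L)
    (∑ k ∈ L, (LinearMap.toSpanSingleton K (PowerSeries K) (PowerSeries.X ^ (r + k * q n))).comp
      (PowerSeries.coeff (r + k * q n)))
    (by
      intro f
      rw [LinearMap.sum_apply]
      refine Submodule.sum_mem _ fun k hk => Submodule.smul_mem _ _ ?_
      exact Submodule.subset_span ⟨k, hk, rfl⟩)

lemma proj_X_pow {n : ℕ} (hn : 3 ≤ n) (r : ℕ) (L : Finset ℕ) (k : ℕ) :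
    (proj K n r L (PowerSeries.X ^ (r + k * q n)) : PowerSeries K) =
      if k ∈ L then PowerSeries.X ^ (r + k * q n) else 0 := by
  have hq := (q_pos hn).ne'
  simp [proj, PowerSeries.coeff_X_pow, hq]

/-- The linear map `ρ_r^L : W_r → T_r^L`, the restriction of `ρ` to `W_r` followed by the
projection onto `T_r^L`. -/
def rhoRes {n : ℕ} (hn : 3 ≤ n) (r : ℕ) (L : Finset ℕ) : W K n r →ₗ[K] T K n r L :=
  (proj K n r L).comp ((rho K hn).toLinearMap.comp (W K n r).subtype)

/-- The `r`-good kernel `ker (ρ_r^{G_r})`, a subspace of `W_r`. -/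
def goodKernel {n : ℕ} (hn : 3 ≤ n) (r : ℕ) : Submodule K (W K n r) :=
  LinearMap.ker (rhoRes K hn r (G n r))

/-- The binomial determinant `b^I_J`: the determinant of the matrix of binomial coefficients
`(i choose j)` with rows `i ∈ I` and columns `j ∈ J` in increasing order, for `I` and `J` of the
same cardinality (and `0` otherwise). -/
def binomDet (I J : Finset ℕ) : ℤ :=
  if h : J.card = I.card then
    Matrix.det (Matrix.of fun i j : Fin I.card =>
      (Nat.choose (I.orderEmbOfFin rfl i) (J.orderEmbOfFin h j) : ℤ))
  else 0

/-- The term `(-1)^j c x^u y^v z^w`. -/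
def term (j : ℕ) (c : ℤ) (u v w : ℕ) : MvPolynomial (Fin 3) K :=
  MvPolynomial.C (((-1) ^ j * c : ℤ) : K) *
    (MvPolynomial.X 0 ^ u * MvPolynomial.X 1 ^ v * MvPolynomial.X 2 ^ w)

open Finset in
/-- The polynomials `g_k`, for `n ≥ 7` odd and `1 ≤ k ≤ n`. All divisions by two are exact and no
subtraction truncates. -/
def gOdd (n k : ℕ) : MvPolynomial (Fin 3) K :=
  if k ≤ n - 3 then
    if Odd k then
      ∑ j ∈ range ((k + 1) / 2 + 1),
        term K j
          (binomDet (Icc (n - k - 2) ((2 * n - k - 3) / 2) \ {(2 * n - k - 3 - 2 * j) / 2})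
            ({0} ∪ Icc ((n - k) / 2) ((n - 3) / 2)))
          ((2 * n - k - 3 - 2 * j) / 2) (2 * j) ((k + 1 - 2 * j) / 2)
    else
      ∑ j ∈ range (k / 2 + 1),
        term K j
          (binomDet (Icc (n - k - 2) ((2 * n - k - 4) / 2) \ {(2 * n - k - 4 - 2 * j) / 2})
            ({0} ∪ Icc ((n - k + 1) / 2) ((n - 3) / 2)))
          ((2 * n - k - 4 - 2 * j) / 2) (1 + 2 * j) ((k - 2 * j) / 2)
  else if k = n - 2 then
    ∑ j ∈ range ((n - 1) / 2 + 1),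
      term K j (Nat.choose ((n - 1) / 2) ((n - 1 - 2 * j) / 2))
        ((n - 1 - 2 * j) / 2) (2 * j) ((n - 1 - 2 * j) / 2)
  else if k = n - 1 then
    ∑ j ∈ range ((n - 3) / 2 + 1),
      term K j (Nat.choose ((n - 3) / 2) ((n - 3 - 2 * j) / 2))
        ((n - 3 - 2 * j) / 2) (1 + 2 * j) ((n - 1 - 2 * j) / 2)
  else
    ∑ j ∈ range ((n - 3) / 2 + 1),
      term K j (Nat.choose ((n - 3) / 2) ((n - 3 - 2 * j) / 2))
        ((n - 3 - 2 * j) / 2) (2 * j) ((n + 1 - 2 * j) / 2)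

open Finset in
/-- The polynomials `g_k`, for `n ≥ 6` even and `1 ≤ k ≤ n`. All divisions by two are exact and no
subtraction truncates. -/
def gEven (n k : ℕ) : MvPolynomial (Fin 3) K :=
  if k ≤ n - 4 then
    if Odd k then
      ∑ j ∈ range ((k + 1) / 2 + 1),
        term K j
          (binomDet (Icc (n - k - 2) ((2 * n - k - 3) / 2) \ {(2 * n - k - 3 - 2 * j) / 2})
            ({0} ∪ Icc ((n - k + 1) / 2) ((n - 2) / 2)))
          ((2 * n - k - 3 - 2 * j) / 2) (2 * j) ((k + 1 - 2 * j) / 2)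
    else
      ∑ j ∈ range (k / 2 + 1),
        term K j
          (binomDet (Icc (n - k - 2) ((2 * n - k - 4) / 2) \ {(2 * n - k - 4 - 2 * j) / 2})
            ({0} ∪ Icc ((n - k + 2) / 2) ((n - 2) / 2)))
          ((2 * n - k - 4 - 2 * j) / 2) (1 + 2 * j) ((k - 2 * j) / 2)
  else if k = n - 3 then
    ∑ j ∈ range ((n - 2) / 2 + 1),
      term K j
        (binomDet (Icc 1 (n / 2) \ {(n - 2 * j) / 2}) ({0} ∪ Icc 2 ((n - 2) / 2)))
        ((n - 2 * j) / 2) (2 * j) ((n - 2 - 2 * j) / 2)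
  else if k = n - 2 then
    MvPolynomial.X 0 * MvPolynomial.X 1 ^ (n - 3) * MvPolynomial.X 2 - MvPolynomial.X 1 ^ (n - 1)
  else if k = n - 1 then
    ∑ j ∈ range ((n - 2) / 2 + 1),
      term K j (Nat.choose ((n - 2) / 2) ((n - 2 - 2 * j) / 2))
        ((n - 2 - 2 * j) / 2) (1 + 2 * j) ((n - 2 - 2 * j) / 2)
  else
    ∑ j ∈ range ((n - 2) / 2 + 1),
      term K j (Nat.choose ((n - 2) / 2) ((n - 2 - 2 * j) / 2))
        ((n - 2 - 2 * j) / 2) (2 * j) ((n - 2 * j) / 2)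

/-- The polynomials `g_1, …, g_n`, for `n ≥ 6`. -/
def g (n k : ℕ) : MvPolynomial (Fin 3) K :=
  if Odd n then gOdd K n k else gEven K n k

end GoodKernels

end

/-! Write `r = aℓ + e` with `ℓ = n - 1`, `2 ≤ e ≤ q + 1` and `a = qh`. Since `e` is small compared
with `a`, the monomials of weight `r` all have total degree `ℓ` and form one string `x^(M-j)
y^(d+2j) z^(w-j)`, where `M = ℓ - ⌈e/2⌉`, `d = e mod 2` and `w = ⌊e/2⌋`. Now `ρ` sends the `j`-th
one to `t^r (1 + t^q)^(M-j)`, so the good kernel consists of the vectors `c` with `∑ c_j (M-j choose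
k) = 0` for all good `k` (`IsDegree.mem_goodKernel_iff`).

The good set is `{0} ∪ [u, v]` (from `IsDegree.mem_G_iff`). Outside the exceptional degree
`r_{n-2}`, `n` even, there is one monomial more than there are good integers, so the kernel is a
line as soon as the square binomial matrix with consecutive rows and columns `{0} ∪ [u, v]` is
invertible (`det_choose_ne_zero`). A dependency between its columns is a polynomial vanishing at
consecutive integers; its difference also vanishes on `[0, u-2]`, which is too many zeros for its
degree.

A generator is given by the signed maximal minors (`sum_binomDet_mul_choose`). When all of `[0,
M-1]` is good, alternating binomial coefficients serve, because an `M`-th difference kills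
polynomials of degree less than `M`. In the exceptional degree `1` is missing from the good set, and
the unused equation at `k = 1` is the second coordinate on a plane. -/

/-! ### Invertibility of binomial matrices -/

-- The functions `x ↦ (x choose j)` with `j < d` are polynomials of degree less than `d`, so `d`
-- zeros kill a combination of them; their triangular values at `0, 1, …` then kill each
-- coefficient.
open Finset in
lemma sum_choose_coeff_eq_zero {K : Type*} [Field K] [CharZero K] (d : ℕ) (c : ℕ → K)
    (Z : Finset ℕ) (hZ : d ≤ #Z)
    (h : ∀ x ∈ Z, ∑ j ∈ range d, c j * (Nat.choose x j : K) = 0) : ∀ j < d, c j = 0 := by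
  classical
  set P : Polynomial K := ∑ j ∈ range d, Polynomial.C (c j / (j.factorial : K)) * descPochhammer K j
    with hP
  have hev : ∀ x : ℕ, P.eval (x : K) = ∑ j ∈ range d, c j * (Nat.choose x j : K) := by
    intro x
    rw [hP, Polynomial.eval_finsetSum]
    refine sum_congr rfl fun j _ => ?_
    have hj : (j.factorial : K) ≠ 0 := by exact_mod_cast j.factorial_ne_zero
    rw [Polynomial.eval_mul, Polynomial.eval_C, descPochhammer_eval_eq_descFactorial,
      Nat.descFactorial_eq_factorial_mul_choose]
    push_cast
    field_simp
  have hdeg : P.degree < (#(Z.image (Nat.cast : ℕ → K)) : WithBot ℕ) := by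
    rw [card_image_of_injective _ Nat.cast_injective]
    refine lt_of_lt_of_le ?_ (Nat.cast_le.mpr hZ)
    rw [Polynomial.degree_lt_iff_coeff_zero]
    intro m hm
    rw [hP, Polynomial.finsetSum_coeff]
    refine sum_eq_zero fun j hj => ?_
    rw [Polynomial.coeff_C_mul, Polynomial.coeff_eq_zero_of_natDegree_lt, mul_zero]
    rw [descPochhammer_natDegree]
    have := mem_range.mp hj
    omega
  have hP0 : P = 0 := by
    refine Polynomial.eq_zero_of_degree_lt_of_eval_finset_eq_zero _ hdeg fun y hy => ?_
    obtain ⟨x, hx, rfl⟩ := mem_image.mp hy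
    rw [hev, h x hx]
  intro j
  induction j using Nat.strong_induction_on with
  | _ j ih =>
    intro hj
    -- At `x = j` the terms above `j` vanish by themselves and those below by induction, which
    -- leaves `c j`.
    have h1 := hev j
    rw [hP0, Polynomial.eval_zero, sum_eq_single j] at h1
    · simpa using h1.symm
    · intro i hi hij
      rcases lt_or_gt_of_ne hij with hlt | hgt
      · rw [ih i hlt (by omega), zero_mul]
      · rw [Nat.choose_eq_zero_of_lt hgt]
        simp
    · intro hn
      exact absurd (mem_range.mpr hj) hn

/-- A discrete version of Rolle's theorem bounds the number of zeros of a combination of the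
functions `x ↦ (x choose j)`, `j ∈ {0} ∪ [u, v]`. -/
lemma coeff_eq_zero_of_sum_choose_eq_zero {K : Type*} [Field K] [CharZero K] {p N u v : ℕ}
    (hu : 1 ≤ u) (huv : u ≤ v + 1) (hN : N + u = v + 2) (hv : v + 1 ≤ p + N) (c : ℕ → K)
    (h : ∀ x, p ≤ x → x < p + N →
      ∑ j ∈ {0} ∪ Finset.Icc u v, c j * (Nat.choose x j : K) = 0) :
    ∀ j ∈ ({0} ∪ Finset.Icc u v : Finset ℕ), c j = 0 := by
  set J : Finset ℕ := {0} ∪ Finset.Icc u v with hJ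
  have memJ : ∀ j, j ∈ J ↔ j = 0 ∨ (u ≤ j ∧ j ≤ v) := by intro j; simp [hJ]
  -- Extending `c` by zero to a full range lets Pascal's rule express the difference of `f` by an
  -- index shift.
  set c' : ℕ → K := fun j => if j ∈ J then c j else 0 with hc'
  set f : ℕ → K := fun x => ∑ j ∈ Finset.range (v + 1), c' j * (Nat.choose x j : K) with hf
  have hfJ : ∀ x, f x = ∑ j ∈ J, c j * (Nat.choose x j : K) := by
    intro x
    have hsub : J ⊆ Finset.range (v + 1) := by
      intro j hj
      rw [memJ] at hj
      rw [Finset.mem_range]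
      omega
    simp only [hf]
    rw [← Finset.sum_subset hsub]
    · refine Finset.sum_congr rfl fun j hj => ?_
      simp [hc', hj]
    · intro j _ hj
      simp [hc', hj]
  have hΔ : ∀ x, f (x + 1) - f x =
      ∑ j ∈ Finset.range v, c' (j + 1) * (Nat.choose x j : K) := by
    intro x
    simp only [hf]
    rw [Finset.sum_range_succ', Finset.sum_range_succ']
    simp only [Nat.choose_zero_right, add_sub_add_right_eq_sub]
    rw [← Finset.sum_sub_distrib]
    refine Finset.sum_congr rfl fun j _ => ?_
    rw [Nat.choose_succ_succ]
    push_cast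
    ring
  -- The difference vanishes at `x < u - 1`, where every binomial present is zero, and at the `N -
  -- 1` points between consecutive zeros of `f`. If the two sets are disjoint they have `(u - 1) +
  -- (N - 1) = v` elements; if they overlap they cover `[0, p + N - 2]`, and `hv` suffices.
  have key : ∀ j < v, c' (j + 1) = 0 := by
    refine sum_choose_coeff_eq_zero v (fun j => c' (j + 1))
      (Finset.range (u - 1) ∪ Finset.Ico p (p + N - 1)) ?_ ?_
    · rcases le_or_gt (u - 1) p with hup | hup
      · rw [Finset.card_union_of_disjoint]
        · simp only [Finset.card_range, Nat.card_Ico]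
          omega
        · rw [Finset.disjoint_left]
          intro x hx hx'
          rw [Finset.mem_range] at hx
          rw [Finset.mem_Ico] at hx'
          omega
      · have hsub : Finset.range (p + N - 1) ⊆
            Finset.range (u - 1) ∪ Finset.Ico p (p + N - 1) := by
          intro x hx
          rw [Finset.mem_range] at hx
          rw [Finset.mem_union, Finset.mem_range, Finset.mem_Ico]
          omega
        have := Finset.card_le_card hsub
        rw [Finset.card_range] at this
        omega
    · intro x hx
      rw [Finset.mem_union, Finset.mem_range, Finset.mem_Ico] at hx
      rcases hx with hx | hx
      · refine Finset.sum_eq_zero fun j _ => ?_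
        rcases le_or_gt j x with hjx | hjx
        · have : j + 1 ∉ J := by rw [memJ]; omega
          simp [hc', this]
        · simp [Nat.choose_eq_zero_of_lt hjx]
      · rw [← hΔ, hfJ, hfJ, h x hx.1 (by omega), h (x + 1) (by omega) (by omega), sub_zero]
  have h0 : c' 0 = 0 := by
    have h1 : f p = 0 := by rw [hfJ]; exact h p le_rfl (by omega)
    simp only [hf] at h1
    rw [Finset.sum_range_succ', Finset.sum_eq_zero] at h1
    · simpa using h1
    · intro j hj
      rw [key j (Finset.mem_range.mp hj), zero_mul]
  intro j hj
  have hcj : c' j = c j := by simp [hc', hj]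
  rw [← hcj]
  rcases (memJ j).mp hj with rfl | hj'
  · exact h0
  · obtain ⟨i, rfl⟩ : ∃ i, j = i + 1 := ⟨j - 1, by omega⟩
    exact key i (by omega)

lemma card_zero_union_Icc {N u v : ℕ} (hu : 1 ≤ u) (huv : u ≤ v + 1) (hN : N + u = v + 2) :
    ({0} ∪ Finset.Icc u v : Finset ℕ).card = N := by
  rw [Finset.card_union_of_disjoint]
  · simp only [Finset.card_singleton, Nat.card_Icc]
    omega
  · simp only [Finset.disjoint_singleton_left, Finset.mem_Icc]
    omega

/-- A vector in the kernel of the matrix is a combination of the functions `x ↦ (x choose j)`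
vanishing at `p, …, p + N - 1`. -/
lemma det_choose_ne_zero {K : Type*} [Field K] [CharZero K] {p N u v : ℕ}
    (hu : 1 ≤ u) (huv : u ≤ v + 1) (hN : N + u = v + 2) (hv : v + 1 ≤ p + N) :
    (Matrix.of fun i j : Fin N => (Nat.choose (p + i) (({0} ∪ Finset.Icc u v : Finset ℕ).orderEmbOfFin
      (card_zero_union_Icc hu huv hN) j) : K)).det ≠ 0 := by
  set J : Finset ℕ := {0} ∪ Finset.Icc u v with hJ
  set e := J.orderIsoOfFin (card_zero_union_Icc hu huv hN) with he
  intro hdet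
  obtain ⟨y, hy0, hy⟩ := Matrix.exists_mulVec_eq_zero_iff.mpr hdet
  apply hy0
  set c : ℕ → K := fun j => if hj : j ∈ J then y (e.symm ⟨j, hj⟩) else 0 with hc
  have hce : ∀ i, c (J.orderEmbOfFin (card_zero_union_Icc hu huv hN) i) = y i := by
    intro i
    have h1 : J.orderEmbOfFin (card_zero_union_Icc hu huv hN) i ∈ J :=
      Finset.orderEmbOfFin_mem _ _ _
    simp only [hc, h1, dif_pos]
    congr 1
    rw [OrderIso.symm_apply_eq]
    rfl
  have hcz : ∀ j ∈ J, c j = 0 := by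
    refine coeff_eq_zero_of_sum_choose_eq_zero hu huv hN hv c fun x hx hx' => ?_
    have h1 := congrFun hy ⟨x - p, by omega⟩
    simp only [Matrix.mulVec, dotProduct, Matrix.of_apply, Pi.zero_apply] at h1
    rw [← hJ, ← Finset.sum_coe_sort, ← h1, ← Equiv.sum_comp e.toEquiv]
    refine Finset.sum_congr rfl fun i _ => ?_
    rw [← hce i, show p + (x - p) = x by omega, mul_comm]
    rfl
  funext i
  rw [← hce i, hcz _ (Finset.orderEmbOfFin_mem _ _ _), Pi.zero_apply]

/-- Uniqueness of the representation of a vector by binomial columns. -/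
lemma eq_zero_of_sum_mul_choose_eq_zero {K : Type*} [Field K] [CharZero K] {p N u v : ℕ}
    (hu : 1 ≤ u) (huv : u ≤ v + 1) (hN : N + u = v + 2) (hv : v + 1 ≤ p + N) (x : ℕ → K)
    (h : ∀ j ∈ ({0} ∪ Finset.Icc u v : Finset ℕ),
      ∑ i ∈ Finset.range N, x i * (Nat.choose (p + i) j : K) = 0) :
    ∀ i < N, x i = 0 := by
  have hdet := det_choose_ne_zero (K := K) hu huv hN hv
  have h1 := Matrix.eq_zero_of_vecMul_eq_zero hdet (v := fun i => x i) (by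
    funext j
    simp only [Matrix.vecMul, dotProduct, Matrix.of_apply, Pi.zero_apply]
    rw [← h _ (Finset.orderEmbOfFin_mem _ (card_zero_union_Icc hu huv hN) j),
      Finset.sum_range])
  intro i hi
  exact congrFun h1 ⟨i, hi⟩

/-! ### Maximal minors as solutions -/

namespace GoodKernels

lemma binomDet_eq_det {N : ℕ} {I J : Finset ℕ} {f g : Fin N → ℕ} (hI : I.card = N)
    (hJ : J.card = N) (hf : StrictMono f) (hfI : ∀ i, f i ∈ I) (hg : StrictMono g)
    (hgJ : ∀ i, g i ∈ J) :
    binomDet I J = (Matrix.of fun i j => (Nat.choose (f i) (g j) : ℤ)).det := by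
  subst hI
  rw [binomDet, dif_pos hJ, Finset.orderEmbOfFin_unique rfl hfI hf,
    Finset.orderEmbOfFin_unique hJ hgJ hg]

/-- Puts the determinant with one row deleted into the shape of a minor in a Laplace expansion. -/
lemma binomDet_Icc_sdiff {p N : ℕ} {J : Finset ℕ} (hJ : J.card = N) (i : Fin (N + 1)) :
    binomDet (Finset.Icc p (p + N) \ {p + (i : ℕ)}) J =
      (Matrix.of fun s t : Fin N =>
        (Nat.choose (p + (i.succAbove s : ℕ)) (J.orderEmbOfFin hJ t) : ℤ)).det := by
  refine binomDet_eq_det (f := fun s => p + (i.succAbove s : ℕ)) ?_ hJ ?_ ?_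
    (J.orderEmbOfFin hJ).strictMono (fun t => Finset.orderEmbOfFin_mem _ _ _)
  · rw [Finset.card_sdiff_of_subset]
    · simp only [Nat.card_Icc, Finset.card_singleton]
      omega
    · simp only [Finset.singleton_subset_iff, Finset.mem_Icc]
      omega
  · intro s t hst
    have := Fin.strictMono_succAbove i hst
    simpa using this
  · intro s
    have h1 := Fin.succAbove_ne i s
    have h2 : (i.succAbove s : ℕ) ≠ i := fun h => h1 (Fin.ext h)
    simp only [Finset.mem_sdiff, Finset.mem_Icc, Finset.mem_singleton]
    omega

/-- The signed maximal minors of a binomial matrix satisfy its linear relations. -/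
lemma sum_binomDet_mul_choose {p N k : ℕ} {J : Finset ℕ} (hJ : J.card = N) (hk : k ∈ J) :
    ∑ j ∈ Finset.range (N + 1), (-1) ^ j *
      binomDet (Finset.Icc p (p + N) \ {p + N - j}) J * (Nat.choose (p + N - j) k : ℤ) = 0 := by
  -- Column `k` is prepended although it already occurs, so that expanding the zero determinant
  -- along it gives the relation.
  set A : Matrix (Fin (N + 1)) (Fin (N + 1)) ℤ := Matrix.of fun i =>
    Fin.cons (Nat.choose (p + i) k : ℤ) fun t => (Nat.choose (p + i) (J.orderEmbOfFin hJ t) : ℤ)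
    with hA
  obtain ⟨t, ht⟩ : ∃ t, J.orderEmbOfFin hJ t = k := by
    have : k ∈ Set.range (J.orderEmbOfFin hJ) := by
      rw [Finset.range_orderEmbOfFin]
      exact hk
    exact this
  have hdet : A.det = 0 := by
    refine Matrix.det_zero_of_column_eq (i := 0) (j := t.succ) (Fin.succ_ne_zero t).symm fun i => ?_
    simp [hA, ht]
  rw [Matrix.det_succ_column_zero] at hdet
  have hsum : ∑ i ∈ Finset.range (N + 1), (-1) ^ i *
      binomDet (Finset.Icc p (p + N) \ {p + i}) J * (Nat.choose (p + i) k : ℤ) = 0 := by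
    rw [Finset.sum_range, ← hdet]
    refine Finset.sum_congr rfl fun i _ => ?_
    rw [binomDet_Icc_sdiff hJ i]
    have hsub : A.submatrix i.succAbove Fin.succ = Matrix.of fun s t : Fin N =>
        (Nat.choose (p + (i.succAbove s : ℕ)) (J.orderEmbOfFin hJ t) : ℤ) := by
      ext s t
      simp [hA]
    rw [hsub]
    simp only [hA, Matrix.of_apply, Fin.cons_zero]
    ring
  rw [← Finset.sum_range_reflect] at hsum
  -- Counting rows from the top instead of the bottom changes every sign by the common factor
  -- `(-1)^N`.
  have h2 : (-1 : ℤ) ^ N * ∑ j ∈ Finset.range (N + 1), (-1) ^ j *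
      binomDet (Finset.Icc p (p + N) \ {p + N - j}) J * (Nat.choose (p + N - j) k : ℤ) = 0 := by
    rw [← hsum, Finset.mul_sum]
    refine Finset.sum_congr rfl fun j hj => ?_
    have hj' := Finset.mem_range.mp hj
    have e1 : N + 1 - 1 - j = N - j := by omega
    have e2 : p + (N - j) = p + N - j := by omega
    have e3 : (-1 : ℤ) ^ N = (-1) ^ (N - j) * (-1) ^ j := by rw [← pow_add]; congr 1; omega
    have e4 : (-1 : ℤ) ^ j * (-1) ^ j = 1 := by rw [← mul_pow]; simp
    rw [e1, e2, e3]
    linear_combination ((-1 : ℤ) ^ (N - j) *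
      binomDet (Finset.Icc p (p + N) \ {p + N - j}) J * (Nat.choose (p + N - j) k : ℤ)) * e4
  exact (mul_eq_zero.mp h2).resolve_left (pow_ne_zero _ (by norm_num))

/-- Deleting the top row leaves the consecutive rows `p, …, p + N - 1`. The determinant is an
integer, so its nonvanishing over `ℚ` passes to any field of characteristic zero. -/
lemma binomDet_Icc_sdiff_last_ne_zero (K : Type*) [Field K] [CharZero K] {p N u v : ℕ} (hu : 1 ≤ u)
    (huv : u ≤ v + 1) (hN : N + u = v + 2) (hv : v + 1 ≤ p + N) :
    (binomDet (Finset.Icc p (p + N) \ {p + N}) ({0} ∪ Finset.Icc u v) : K) ≠ 0 := by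
  have h1 := binomDet_Icc_sdiff (p := p) (card_zero_union_Icc hu huv hN) (Fin.last N)
  rw [Fin.val_last] at h1
  rw [h1]
  have h2 := det_choose_ne_zero (K := ℚ) hu huv hN hv
  simp only [Fin.succAbove_last, Fin.val_castSucc]
  rw [Int.cast_ne_zero]
  intro h0
  apply h2
  have h3 := congrArg (Int.cast : ℤ → ℚ) h0
  rw [Int.cast_det, Int.cast_zero] at h3
  rw [← h3]
  congr 1

end GoodKernels

/-- Trinomial revision, `(N choose N-j)(N-j choose k) = (N choose k)(N-k choose j)`, reduces this to
the alternating sum of row `N - k > 0` of Pascal's triangle. -/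
lemma sum_neg_one_pow_mul_choose_mul_choose {N k : ℕ} (hk : k < N) :
    ∑ j ∈ Finset.range (N + 1), (-1 : ℤ) ^ j * (Nat.choose N (N - j) : ℤ) *
      (Nat.choose (N - j) k : ℤ) = 0 := by
  have h1 : ∀ j ∈ Finset.range (N + 1), (-1 : ℤ) ^ j * (Nat.choose N (N - j) : ℤ) *
      (Nat.choose (N - j) k : ℤ) = (Nat.choose N k : ℤ) * ((-1) ^ j * (Nat.choose (N - k) j : ℤ)) := by
    intro j hj
    have hj' := Finset.mem_range.mp hj
    rcases le_or_gt k (N - j) with hkj | hkj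
    · have h2 : Nat.choose N (N - j) * Nat.choose (N - j) k =
          Nat.choose N k * Nat.choose (N - k) j := by
        rw [Nat.choose_mul hkj, Nat.choose_symm_of_eq_add (show N - k = (N - j - k) + j by omega)]
      have h3 : (Nat.choose N (N - j) : ℤ) * Nat.choose (N - j) k =
          Nat.choose N k * Nat.choose (N - k) j := by exact_mod_cast h2
      linear_combination (-1 : ℤ) ^ j * h3
    · rw [Nat.choose_eq_zero_of_lt hkj, Nat.choose_eq_zero_of_lt (show N - k < j by omega)]
      simp
  rw [Finset.sum_congr rfl h1, ← Finset.mul_sum,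
    ← Finset.sum_subset (s₁ := Finset.range (N - k + 1)),
    Int.alternating_sum_range_choose_of_ne (by omega), mul_zero]
  · exact Finset.range_subset_range.mpr (by omega)
  · intro j _ hj
    rw [Finset.mem_range] at hj
    rw [Nat.choose_eq_zero_of_lt (by omega)]
    simp

/-! ### Factorizations and good integers -/

namespace GoodKernels

/-- The exponents of `x^u y^v z^w`. -/
noncomputable def expo (u v w : ℕ) : Fin 3 →₀ ℕ :=
  Finsupp.single 0 u + Finsupp.single 1 v + Finsupp.single 2 w

@[simp] lemma expo_zero (u v w : ℕ) : expo u v w 0 = u := by simp [expo]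
@[simp] lemma expo_one (u v w : ℕ) : expo u v w 1 = v := by simp [expo]
@[simp] lemma expo_two (u v w : ℕ) : expo u v w 2 = w := by simp [expo]

/-- A sum of `L` generators is `aL + E` with `E ≤ 2L`; carrying multiples of `a` out of `E` only
raises the quotient and lowers the remainder. -/
lemma mod_le_of_mem_S {n s : ℕ} (ha : 0 < a n) (hs : s ∈ S n) :
    s % a n ≤ 2 * (s / a n) := by
  have h1 : ∃ L E, E ≤ 2 * L ∧ s = a n * L + E := by
    refine AddSubmonoid.closure_induction
      (motive := fun s _ => ∃ L E, E ≤ 2 * L ∧ s = a n * L + E)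
      ?_ ⟨0, 0, le_rfl, by simp⟩ ?_ hs
    · rintro x (rfl | rfl | rfl)
      · exact ⟨1, 0, by simp, by simp⟩
      · exact ⟨1, 1, by simp, by simp⟩
      · exact ⟨1, 2, by simp, by simp⟩
    · rintro x y _ _ ⟨L, E, hE, rfl⟩ ⟨L', E', hE', rfl⟩
      exact ⟨L + L', E + E', by omega, by ring⟩
  obtain ⟨L, E, hE, rfl⟩ := h1
  rw [Nat.mul_add_mod, Nat.mul_add_div ha]
  have h2 := Nat.mod_le E (a n)
  have h3 := Nat.zero_le (E / a n)
  omega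

lemma mul_add_mem_S (n : ℕ) {L E : ℕ} (hE : E ≤ 2 * L) :
    a n * L + E ∈ S n := by
  have h0 : a n ∈ S n := AddSubmonoid.subset_closure (by simp)
  have h1 : a n + 1 ∈ S n := AddSubmonoid.subset_closure (by simp)
  have h2 : a n + 2 ∈ S n := AddSubmonoid.subset_closure (by simp)
  -- The factorization with as many `a + 2` as possible and at most one `a + 1`.
  have h3 : a n * L + E = (L - (E + 1) / 2) • a n + (E % 2) • (a n + 1) + (E / 2) • (a n + 2) := by
    have h4 : L = (L - (E + 1) / 2) + E % 2 + E / 2 := by omega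
    have h5 : E = E % 2 + 2 * (E / 2) := by omega
    generalize L - (E + 1) / 2 = u at *
    generalize E % 2 = v at *
    generalize E / 2 = w at *
    rw [h4, h5]
    simp only [smul_eq_mul]
    ring
  rw [h3]
  exact add_mem (add_mem (nsmul_mem h0 _) (nsmul_mem h1 _)) (nsmul_mem h2 _)

lemma phi₁_mul_add {n L E : ℕ} (hE : E < a n) :
    phi₁ n (a n * L + E) = L - (E + 1) / 2 := by
  rw [phi₁, Nat.mul_add_mod, Nat.mod_eq_of_lt hE, Nat.mul_add_div (by omega),
    Nat.div_eq_of_lt hE, add_zero]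

/-- The parameters of a degree `r = aℓ + e`, where `a = q h` and `ℓ = n - 1`. -/
structure IsDegree (n l h e r : ℕ) : Prop where
  a_eq : a n = q n * h
  three_le : 3 ≤ h
  q_eq : (q n = 2 * h + 1 ∧ l = 2 * h) ∨ (q n = 2 * h - 1 ∧ l = 2 * h - 1)
  two_le : 2 ≤ e
  e_le : e ≤ q n + 1
  r_eq : r = a n * l + e

namespace IsDegree

variable {n l h e r : ℕ} (P : IsDegree n l h e r)
include P

lemma three_q_le : 3 * q n ≤ a n := by
  rw [P.a_eq, mul_comm]
  exact Nat.mul_le_mul_left _ P.three_le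

lemma mem_factorizations_iff (α : Fin 3 →₀ ℕ) : α ∈ factorizations n r ↔
    ∃ j ≤ min (l - (e + 1) / 2) (e / 2),
      α = expo (l - (e + 1) / 2 - j) (e % 2 + 2 * j) (e / 2 - j) := by
  have h1 := P.three_q_le
  have h2 := P.q_eq
  have h3 := P.two_le
  have h4 := P.e_le
  have h5 := P.three_le
  constructor
  · intro hα
    simp only [factorizations, Set.mem_ofPred_eq, P.r_eq] at hα
    -- The total degree is forced: fewer factors stay below `aℓ + e` because `a ≥ 3q` dominates
    -- `2ℓ`, and more give at least `aℓ + a`.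
    have hL : α 0 + α 1 + α 2 = l := by
      rcases lt_trichotomy (α 0 + α 1 + α 2) l with hlt | heq | hgt
      · have : a n * (α 0 + α 1 + α 2 + 1) ≤ a n * l := Nat.mul_le_mul_left _ hlt
        have h6 : a n * (α 0 + α 1 + α 2 + 1) = α 0 * a n + α 1 * a n + α 2 * a n + a n := by ring
        have h7 : α 0 * a n + α 1 * (a n + 1) + α 2 * (a n + 2) =
          α 0 * a n + α 1 * a n + α 2 * a n + α 1 + 2 * α 2 := by ring
        omega
      · exact heq
      · have : a n * (l + 1) ≤ a n * (α 0 + α 1 + α 2) := Nat.mul_le_mul_left _ hgt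
        have h6 : a n * (α 0 + α 1 + α 2) = α 0 * a n + α 1 * a n + α 2 * a n := by ring
        have h7 : α 0 * a n + α 1 * (a n + 1) + α 2 * (a n + 2) =
          α 0 * a n + α 1 * a n + α 2 * a n + α 1 + 2 * α 2 := by ring
        have h8 : a n * (l + 1) = a n * l + a n := by ring
        omega
    have hE : α 1 + 2 * α 2 = e := by
      rw [← hL] at hα
      linarith
    refine ⟨α 1 / 2, by omega, ?_⟩
    ext i
    fin_cases i
    · simp only [Fin.zero_eta, expo_zero]; omega
    · simp only [Fin.mk_one, expo_one]; omega
    · simp only [Fin.reduceFinMk, expo_two]; omega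
  · rintro ⟨j, hj, rfl⟩
    simp only [factorizations, Set.mem_ofPred_eq, expo_zero, expo_one, expo_two, P.r_eq]
    have h6 : (l - (e + 1) / 2 - j) + (e % 2 + 2 * j) + (e / 2 - j) = l := by omega
    have h7 : (e % 2 + 2 * j) + 2 * (e / 2 - j) = e := by omega
    generalize l - (e + 1) / 2 - j = u at *
    generalize e % 2 + 2 * j = v at *
    generalize e / 2 - j = w at *
    rw [← h6, ← h7]
    ring

/-- Only two competitors `s = r + iq` matter: `i = 1`, and the first `i` for which `s` reaches the
block of `a(ℓ + 1)`, namely `h`, or `h - 1` if `e ≥ q`. Inside the block of `aℓ`, a shift by `2q` or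
more leaves the semigroup since `e + 2q > 2ℓ`. -/
lemma mem_G_iff (k : ℕ) : k ∈ G n r ↔ k ≤ l - (e + 1) / 2 ∧ k < (if e < q n then h else h - 1) ∧
    (k = 0 ∨ l + 2 ≤ k + (e + q n + 1) / 2) := by
  have h1 := P.three_q_le
  have h2 := P.q_eq
  have h3 := P.two_le
  have h4 := P.e_le
  have h5 := P.three_le
  have h6 := P.a_eq
  have hea : e < a n := by omega
  simp only [G, H, Finset.mem_filter, Finset.mem_Icc, zero_le, true_and, IsGood]
  rw [P.r_eq, phi₁_mul_add hea]
  have hdist : ∀ i j, j ≤ i → i * q n = (i - j) * q n + j * q n := by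
    intro i j hij
    rw [← add_mul, Nat.sub_add_cancel hij]
  refine and_congr_right fun hk => ⟨fun hgood => ⟨?_, ?_⟩, ?_⟩
  · by_contra hlt
    split_ifs at hlt with heq
    · refine hgood (a n * (l + 1) + e) (mul_add_mem_S n (by omega)) ?_ (k - h) ?_ ?_
      · rw [mul_add]; omega
      · rw [phi₁_mul_add hea]; omega
      · rw [hdist k h (by omega), mul_add, h6]; ring
    · have hqh : q n * h = (h - 1) * q n + q n := by
        rw [← Nat.succ_mul, mul_comm, Nat.succ_eq_add_one, Nat.sub_add_cancel (by omega)]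
      refine hgood (a n * (l + 1) + (e - q n)) (mul_add_mem_S n (by omega)) ?_ (k - (h - 1)) ?_ ?_
      · rw [mul_add]; omega
      · rw [phi₁_mul_add (by omega)]; omega
      · rw [hdist k (h - 1) (by omega), mul_add]
        omega
  · by_contra hlt
    refine hgood (a n * l + (e + q n)) (mul_add_mem_S n (by omega)) (by omega) (k - 1) ?_ ?_
    · rw [phi₁_mul_add (by omega)]; omega
    · rw [hdist k 1 (by omega)]; ring
  · rintro ⟨hkh, hk0⟩ s hs hrs j hj heq
    have hjk : j < k := by
      by_contra hjk
      have := Nat.mul_le_mul_right (q n) (not_lt.mp hjk)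
      omega
    have hs' : s = a n * l + (e + (k - j) * q n) := by
      have := hdist k j hjk.le
      omega
    have hlt : e + (k - j) * q n < a n := by
      split_ifs at hkh with heq'
      · have h7 : (k - j) * q n ≤ (h - 1) * q n := Nat.mul_le_mul_right _ (by omega)
        have h8 := hdist h 1 (by omega)
        have h9 : q n * h = h * q n := mul_comm _ _
        omega
      · have h7 : (k - j) * q n ≤ (h - 2) * q n := Nat.mul_le_mul_right _ (by omega)
        have h8 := hdist h 2 (by omega)
        have h9 : q n * h = h * q n := mul_comm _ _
        omega
    have hmod := mod_le_of_mem_S (by omega) hs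
    rw [hs', Nat.mul_add_mod, Nat.mod_eq_of_lt hlt, Nat.mul_add_div (by omega),
      Nat.div_eq_of_lt hlt, add_zero] at hmod
    -- Membership in the semigroup bounds the remainder `e + (k - j)q` by `2ℓ`, which excludes `k -
    -- j ≥ 2`.
    have hm : k - j = 1 := by
      by_contra hm
      have : 2 * q n ≤ (k - j) * q n := Nat.mul_le_mul_right _ (by omega)
      omega
    rw [hs', phi₁_mul_add hlt, hm] at hj
    rw [hm] at hmod
    omega

end IsDegree

/-! ### The good kernel as a binomial linear system -/

variable {K : Type*} [Field K]

lemma rhoRes_eq_zero_iff {n : ℕ} (hn : 3 ≤ n) (r : ℕ) (L : Finset ℕ) (f : W K n r) :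
    rhoRes K hn r L f = 0 ↔
      ∀ k ∈ L, PowerSeries.coeff (r + k * q n) (rho K hn (f : MvPowerSeries (Fin 3) K)) = 0 := by
  have hq := (q_pos hn).ne'
  rw [← Submodule.coe_eq_zero]
  simp only [rhoRes, proj, LinearMap.comp_apply, LinearMap.codRestrict_apply, LinearMap.sum_apply,
    Submodule.subtype_apply, AlgHom.toLinearMap_apply, LinearMap.toSpanSingleton_apply]
  constructor
  · intro h k hk
    have h1 := congrArg (PowerSeries.coeff (r + k * q n)) h
    simpa [PowerSeries.coeff_X_pow, hq, hk] using h1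
  · intro h
    refine Finset.sum_eq_zero fun k hk => ?_
    rw [h k hk, zero_smul]

lemma coeff_one_add_X_pow_pow {q : ℕ} (hq : q ≠ 0) (m k : ℕ) :
    PowerSeries.coeff (k * q) ((1 + PowerSeries.X ^ q : PowerSeries K) ^ m) = (Nat.choose m k : K) := by
  rw [add_comm, add_pow, map_sum]
  have h1 : ∀ i, PowerSeries.coeff (k * q) (((PowerSeries.X : PowerSeries K) ^ q) ^ i * 1 ^ (m - i) *
      (Nat.choose m i : PowerSeries K)) = if k = i then (Nat.choose m i : K) else 0 := by
    intro i
    rw [one_pow, mul_one, ← pow_mul, ← map_natCast (PowerSeries.C (R := K)), PowerSeries.coeff_mul_C,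
      PowerSeries.coeff_X_pow, mul_comm q i]
    simp [hq]
  simp only [h1, Finset.sum_ite_eq, Finset.mem_range]
  split_ifs with h
  · rfl
  · rw [Nat.choose_eq_zero_of_lt (by omega), Nat.cast_zero]

/-- The variables `y` and `z` contribute only powers of `t`; the coefficient comes from `(1 +
t^q)^(α 0)`. -/
lemma coeff_rho_monomial {n : ℕ} (hn : 3 ≤ n) {r : ℕ} {α : Fin 3 →₀ ℕ} (hα : α ∈ factorizations n r)
    (c : K) (k : ℕ) : PowerSeries.coeff (r + k * q n) (rho K hn (MvPowerSeries.monomial α c)) =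
      c * (Nat.choose (α 0) k : K) := by
  have h1 : rho K hn (MvPowerSeries.monomial α c) =
      PowerSeries.C c * (PowerSeries.X ^ r * (1 + PowerSeries.X ^ q n) ^ α 0) := by
    have h2 := MvPowerSeries.substAlgHom_monomial (R := K) (hasSubst_rhoVal K hn) α c
    rw [rho]
    refine h2.trans ?_
    rw [Finsupp.prod_fintype _ _ (fun _ => pow_zero _), Fin.prod_univ_three]
    simp only [rhoVal, Matrix.cons_val_zero, Matrix.cons_val_one, Matrix.cons_val]
    congr 1
    have h3 : α 0 * a n + α 1 * (a n + 1) + α 2 * (a n + 2) = r := hα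
    rw [← h3, mul_pow]
    ring
  rw [h1, PowerSeries.coeff_C_mul, add_comm r, PowerSeries.coeff_X_pow_mul,
    coeff_one_add_X_pow_pow (q_pos hn).ne']

namespace IsDegree

variable {n l h e r : ℕ} (P : IsDegree n l h e r)
include P

lemma eq_sum_monomial (f : W K n r) : (f : MvPowerSeries (Fin 3) K) =
    ∑ j ∈ Finset.range (min (l - (e + 1) / 2) (e / 2) + 1),
      MvPowerSeries.monomial (expo (l - (e + 1) / 2 - j) (e % 2 + 2 * j) (e / 2 - j))
        (MvPowerSeries.coeff (expo (l - (e + 1) / 2 - j) (e % 2 + 2 * j) (e / 2 - j))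
          (f : MvPowerSeries (Fin 3) K)) := by
  classical
  ext α
  rw [map_sum]
  simp only [MvPowerSeries.coeff_monomial]
  by_cases hα : α ∈ factorizations n r
  · obtain ⟨j, hj, rfl⟩ := (P.mem_factorizations_iff α).mp hα
    rw [Finset.sum_eq_single j]
    · simp
    · intro i _ hij
      rw [if_neg]
      intro h0
      have h1 := DFunLike.congr_fun h0 1
      rw [expo_one, expo_one] at h1
      omega
    · intro hn
      rw [Finset.mem_range] at hn
      omega
  · rw [Finset.sum_eq_zero]
    · by_contra h0
      exact hα (f.2 α h0)
    · intro j hj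
      rw [if_neg]
      rintro rfl
      exact hα ((P.mem_factorizations_iff _).mpr
        ⟨j, Nat.lt_succ_iff.mp (Finset.mem_range.mp hj), rfl⟩)

lemma ext_coeff {f f' : W K n r} (hf : ∀ j ≤ min (l - (e + 1) / 2) (e / 2),
    MvPowerSeries.coeff (expo (l - (e + 1) / 2 - j) (e % 2 + 2 * j) (e / 2 - j))
      (f : MvPowerSeries (Fin 3) K) =
    MvPowerSeries.coeff (expo (l - (e + 1) / 2 - j) (e % 2 + 2 * j) (e / 2 - j))
      (f' : MvPowerSeries (Fin 3) K)) : f = f' := by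
  apply Subtype.ext
  rw [P.eq_sum_monomial f, P.eq_sum_monomial f']
  refine Finset.sum_congr rfl fun j hj => ?_
  rw [hf j (Nat.lt_succ_iff.mp (Finset.mem_range.mp hj))]

lemma mem_goodKernel_iff (hn : 3 ≤ n) (f : W K n r) : f ∈ goodKernel K hn r ↔
    ∀ k ∈ G n r, ∑ j ∈ Finset.range (min (l - (e + 1) / 2) (e / 2) + 1),
      MvPowerSeries.coeff (expo (l - (e + 1) / 2 - j) (e % 2 + 2 * j) (e / 2 - j))
        (f : MvPowerSeries (Fin 3) K) * (Nat.choose (l - (e + 1) / 2 - j) k : K) = 0 := by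
  rw [goodKernel, LinearMap.mem_ker, rhoRes_eq_zero_iff]
  refine forall₂_congr fun k _ => ?_
  conv_lhs => rw [P.eq_sum_monomial f, map_sum, map_sum]
  rw [Finset.sum_congr rfl]
  intro j hj
  rw [coeff_rho_monomial hn ((P.mem_factorizations_iff _).mpr
    ⟨j, Nat.lt_succ_iff.mp (Finset.mem_range.mp hj), rfl⟩), expo_zero]

end IsDegree

end GoodKernels

/-! ### Bases of good kernels -/

lemma exists_basis_fin_one {K V : Type*} [Field K] [AddCommGroup V] [Module K V] (x : V)
    (hx : x ≠ 0) (h : ∀ y, ∃ c : K, y = c • x) :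
    Module.finrank K V = 1 ∧ ∃ b : Module.Basis (Fin 1) K V, b 0 = x := by
  have hli : LinearIndependent K ![x] := by
    rw [linearIndependent_unique_iff]
    simpa using hx
  let b : Module.Basis (Fin 1) K V := Module.Basis.mk hli (by
    rintro y -
    obtain ⟨c, rfl⟩ := h y
    exact Submodule.smul_mem _ _ (Submodule.subset_span ⟨0, rfl⟩))
  exact ⟨by rw [Module.finrank_eq_card_basis b, Fintype.card_fin], b, by simp [b]⟩

lemma exists_basis_fin_two {K V : Type*} [Field K] [AddCommGroup V] [Module K V] (x y : V)
    (hxy : ∀ s t : K, s • x + t • y = 0 → s = 0 ∧ t = 0) (h : ∀ z, ∃ s t : K, z = s • x + t • y) :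
    Module.finrank K V = 2 ∧ ∃ b : Module.Basis (Fin 2) K V, b 0 = x ∧ b 1 = y := by
  have hli : LinearIndependent K ![x, y] := LinearIndependent.pair_iff.mpr hxy
  let b : Module.Basis (Fin 2) K V := Module.Basis.mk hli (by
    rintro z -
    obtain ⟨s, t, rfl⟩ := h z
    exact add_mem (Submodule.smul_mem _ _ (Submodule.subset_span ⟨0, rfl⟩))
      (Submodule.smul_mem _ _ (Submodule.subset_span ⟨1, rfl⟩)))
  exact ⟨by rw [Module.finrank_eq_card_basis b, Fintype.card_fin], b, by simp [b], by simp [b]⟩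

/-- Once the leading unknown is zero, the other `N` unknowns belong to the consecutive rows `M - N,
…, M - 1`, a square invertible system. -/
lemma eq_zero_of_sum_mul_choose_sub_eq_zero {K : Type*} [Field K] [CharZero K] {M N u v : ℕ}
    (hu : 1 ≤ u) (huv : u ≤ v + 1) (hN : N + u = v + 2) (hv : v + 1 ≤ M) (hM : N ≤ M) (x : ℕ → K)
    (h0 : x 0 = 0) (h : ∀ k ∈ ({0} ∪ Finset.Icc u v : Finset ℕ),
      ∑ j ∈ Finset.range (N + 1), x j * (Nat.choose (M - j) k : K) = 0) :
    ∀ j ≤ N, x j = 0 := by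
  have key := eq_zero_of_sum_mul_choose_eq_zero (p := M - N) hu huv hN (by omega)
    (fun i => x (N - i)) (by
      intro k hk
      rw [← h k hk, Finset.sum_range_succ', h0, zero_mul, add_zero, ← Finset.sum_range_reflect]
      refine Finset.sum_congr rfl fun i hi => ?_
      have := Finset.mem_range.mp hi
      rw [show N - (N - 1 - i) = i + 1 by omega, show M - N + (N - 1 - i) = M - (i + 1) by omega])
  intro j hj
  rcases Nat.eq_zero_or_pos j with rfl | hj0
  · exact h0
  · have := key (N - j) (by omega)
    rwa [show N - (N - j) = j by omega] at this

namespace GoodKernels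

lemma term_eq_monomial (K : Type*) [Field K] (j : ℕ) (c : ℤ) (u v w : ℕ) :
    term K j c u v w = MvPolynomial.monomial (expo u v w) (((-1) ^ j * c : ℤ) : K) := by
  rw [term, expo, MvPolynomial.X_pow_eq_monomial, MvPolynomial.X_pow_eq_monomial,
    MvPolynomial.X_pow_eq_monomial, MvPolynomial.monomial_mul, MvPolynomial.monomial_mul,
    MvPolynomial.C_mul_monomial]
  simp

/-- The polynomial `∑ (-1)^j b_j x^(M-j) y^(d+2j) z^(w-j)` over `0 ≤ j ≤ c`. -/
noncomputable def altPoly (K : Type*) [Field K] (M d w c : ℕ) (b : ℕ → ℤ) : MvPolynomial (Fin 3) K :=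
  ∑ j ∈ Finset.range (c + 1), term K j (b j) (M - j) (d + 2 * j) (w - j)

lemma coeff_altPoly (K : Type*) [Field K] (M d w c : ℕ) (b : ℕ → ℤ) {j : ℕ} (hj : j ≤ c) :
    MvPowerSeries.coeff (expo (M - j) (d + 2 * j) (w - j))
      (altPoly K M d w c b : MvPowerSeries (Fin 3) K) = (-1) ^ j * (b j : K) := by
  classical
  rw [MvPolynomial.coeff_coe, altPoly, MvPolynomial.coeff_sum, Finset.sum_eq_single j]
  · rw [term_eq_monomial, MvPolynomial.coeff_monomial, if_pos rfl]
    push_cast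
    rfl
  · intro i _ hij
    rw [term_eq_monomial, MvPolynomial.coeff_monomial, if_neg]
    intro h0
    have h1 := DFunLike.congr_fun h0 1
    rw [expo_one, expo_one] at h1
    omega
  · intro hn
    rw [Finset.mem_range] at hn
    omega

namespace IsDegree

variable {K : Type*} [Field K] {n l h e r : ℕ} (P : IsDegree n l h e r)
include P

lemma altPoly_mem_W {c : ℕ} (hc : c ≤ min (l - (e + 1) / 2) (e / 2)) (b : ℕ → ℤ) :
    (altPoly K (l - (e + 1) / 2) (e % 2) (e / 2) c b : MvPowerSeries (Fin 3) K) ∈ W K n r := by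
  classical
  intro α hα
  rw [MvPolynomial.coeff_coe, altPoly, MvPolynomial.coeff_sum] at hα
  obtain ⟨j, hj, hne⟩ := Finset.exists_ne_zero_of_sum_ne_zero hα
  rw [term_eq_monomial, MvPolynomial.coeff_monomial] at hne
  have h1 := (ite_ne_right_iff.mp hne).1
  have := Finset.mem_range.mp hj
  exact (P.mem_factorizations_iff α).mpr ⟨j, by omega, h1.symm⟩

lemma altPoly_mem_goodKernel (hn : 3 ≤ n) {M c : ℕ} (hM : l - (e + 1) / 2 = M)
    (hc : min (l - (e + 1) / 2) (e / 2) = c) (b : ℕ → ℤ)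
    (hb : ∀ k ∈ G n r, ∑ j ∈ Finset.range (c + 1),
      (-1) ^ j * b j * (Nat.choose (M - j) k : ℤ) = 0) :
    (⟨altPoly K (l - (e + 1) / 2) (e % 2) (e / 2) c b, P.altPoly_mem_W hc.ge b⟩ : W K n r) ∈
      goodKernel K hn r := by
  subst hM hc
  rw [P.mem_goodKernel_iff hn]
  intro k hk
  have h1 := congrArg (Int.cast : ℤ → K) (hb k hk)
  push_cast at h1
  rw [← h1]
  refine Finset.sum_congr rfl fun j hj => ?_
  rw [coeff_altPoly _ _ _ _ _ _ (Nat.lt_succ_iff.mp (Finset.mem_range.mp hj))]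

/-- The good kernel is a line if the good set has the form `{0} ∪ [u, v]` and there is exactly one
monomial more than there are good integers. -/
lemma exists_basis_goodKernel [CharZero K] (hn : 3 ≤ n) {M N u v : ℕ} (hM : l - (e + 1) / 2 = M)
    (hc : min (l - (e + 1) / 2) (e / 2) = N) (hu : 1 ≤ u) (huv : u ≤ v + 1)
    (hN : N + u = v + 2) (hv : v + 1 ≤ M) (hG : G n r = {0} ∪ Finset.Icc u v) (b : ℕ → ℤ)
    (hb0 : (b 0 : K) ≠ 0) (hb : ∀ k ∈ ({0} ∪ Finset.Icc u v : Finset ℕ),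
      ∑ j ∈ Finset.range (N + 1), (-1) ^ j * b j * (Nat.choose (M - j) k : ℤ) = 0) :
    Module.finrank K (goodKernel K hn r) = 1 ∧
      ∃ B : Module.Basis (Fin 1) K (goodKernel K hn r),
        ((B 0 : W K n r) : MvPowerSeries (Fin 3) K) = altPoly K M (e % 2) (e / 2) N b := by
  have hmem := P.altPoly_mem_goodKernel (K := K) hn hM hc b (by rwa [hG])
  set x : goodKernel K hn r := ⟨_, hmem⟩ with hx
  have hxc : ∀ j ≤ N, MvPowerSeries.coeff (expo (M - j) (e % 2 + 2 * j) (e / 2 - j))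
      ((x : W K n r) : MvPowerSeries (Fin 3) K) = (-1) ^ j * (b j : K) := by
    intro j hj
    rw [← hM]
    exact coeff_altPoly K _ _ _ _ b hj
  obtain ⟨h1, B, hB⟩ := exists_basis_fin_one (K := K) x (by
      intro h0
      have h1 := hxc 0 (Nat.zero_le _)
      rw [h0] at h1
      apply hb0
      simpa using h1.symm) (by
      intro y
      -- The ratio of leading coefficients, chosen so that `y - t • x` has leading coefficient zero.
      set t : K := MvPowerSeries.coeff (expo (M - 0) (e % 2 + 2 * 0) (e / 2 - 0))
        ((y : W K n r) : MvPowerSeries (Fin 3) K) / (b 0 : K) with ht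
      refine ⟨t, ?_⟩
      rw [← sub_eq_zero]
      apply Subtype.ext
      apply P.ext_coeff
      rw [hc, hM]
      have hz := (P.mem_goodKernel_iff hn _).mp (y - t • x).2
      rw [hc, hM, hG] at hz
      refine eq_zero_of_sum_mul_choose_sub_eq_zero hu huv hN hv (by omega)
        (fun j => MvPowerSeries.coeff (expo (M - j) (e % 2 + 2 * j) (e / 2 - j))
        (((y - t • x : goodKernel K hn r) : W K n r) : MvPowerSeries (Fin 3) K)) ?_ hz
      have h2 := hxc 0 (Nat.zero_le _)
      simp only [Submodule.coe_sub, Submodule.coe_smul, map_sub, map_smul, smul_eq_mul, h2, ht]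
      field_simp
      ring)
  refine ⟨h1, B, ?_⟩
  rw [hB, hx, ← hM]

/-- The good kernel is a plane if the good set is `{0} ∪ [2, M - 1]` and the exponents of `x` in the
monomials of degree `r` are `0, …, M`. -/
lemma exists_basis_goodKernel_two [CharZero K] (hn : 3 ≤ n) {M : ℕ} (hM : l - (e + 1) / 2 = M)
    (hc : min (l - (e + 1) / 2) (e / 2) = M) (hM2 : 2 ≤ M)
    (hG : ∀ k, k ∈ G n r ↔ k < M ∧ k ≠ 1) (b b' : ℕ → ℤ) (hb0 : b 0 = 0)
    (hb0' : (b' 0 : K) ≠ 0)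
    (hb1 : ∑ j ∈ Finset.range (M + 1), (-1) ^ j * b j * ((M - j : ℕ) : ℤ) = 1)
    (hb1' : ∑ j ∈ Finset.range (M + 1), (-1) ^ j * b' j * ((M - j : ℕ) : ℤ) = 0)
    (hb : ∀ k < M, k ≠ 1 →
      ∑ j ∈ Finset.range (M + 1), (-1) ^ j * b j * (Nat.choose (M - j) k : ℤ) = 0)
    (hb' : ∀ k < M, k ≠ 1 →
      ∑ j ∈ Finset.range (M + 1), (-1) ^ j * b' j * (Nat.choose (M - j) k : ℤ) = 0) :
    Module.finrank K (goodKernel K hn r) = 2 ∧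
      ∃ B : Module.Basis (Fin 2) K (goodKernel K hn r),
        ((B 0 : W K n r) : MvPowerSeries (Fin 3) K) = altPoly K M (e % 2) (e / 2) M b ∧
        ((B 1 : W K n r) : MvPowerSeries (Fin 3) K) = altPoly K M (e % 2) (e / 2) M b' := by
  have hmem := P.altPoly_mem_goodKernel (K := K) hn hM hc b
    (fun k hk => hb k ((hG k).mp hk).1 ((hG k).mp hk).2)
  have hmem' := P.altPoly_mem_goodKernel (K := K) hn hM hc b'
    (fun k hk => hb' k ((hG k).mp hk).1 ((hG k).mp hk).2)
  set x : goodKernel K hn r := ⟨_, hmem⟩ with hx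
  set x' : goodKernel K hn r := ⟨_, hmem'⟩ with hx'
  -- `φ j` reads the `j`-th coefficient and `ψ` is the left side of the equation for the non-good `k
  -- = 1`. The pair `(φ 0, ψ)` gives coordinates on the kernel, triangular with respect to `x'` and
  -- `x`.
  let φ : ℕ → W K n r →ₗ[K] K := fun j =>
    (MvPowerSeries.coeff (expo (M - j) (e % 2 + 2 * j) (e / 2 - j))).comp (W K n r).subtype
  let ψ : W K n r →ₗ[K] K := ∑ j ∈ Finset.range (M + 1), ((M - j : ℕ) : K) • φ j
  have hψ : ∀ f, ψ f = ∑ j ∈ Finset.range (M + 1), φ j f * ((M - j : ℕ) : K) := by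
    intro f
    simp only [ψ, LinearMap.sum_apply, LinearMap.smul_apply, smul_eq_mul, mul_comm]
  have hφx : ∀ j ≤ M, φ j x = (-1) ^ j * (b j : K) := by
    intro j hj
    simp only [φ]
    rw [← hM]
    exact coeff_altPoly K _ _ _ _ b (by omega)
  have hφx' : ∀ j ≤ M, φ j x' = (-1) ^ j * (b' j : K) := by
    intro j hj
    simp only [φ]
    rw [← hM]
    exact coeff_altPoly K _ _ _ _ b' (by omega)
  have hψx : ψ x = 1 := by
    have h1 := congrArg (Int.cast : ℤ → K) hb1
    push_cast at h1
    rw [hψ, ← h1]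
    refine Finset.sum_congr rfl fun j hj => ?_
    rw [hφx j (Nat.lt_succ_iff.mp (Finset.mem_range.mp hj))]
  have hψx' : ψ x' = 0 := by
    have h1 := congrArg (Int.cast : ℤ → K) hb1'
    push_cast at h1
    rw [hψ, ← h1]
    refine Finset.sum_congr rfl fun j hj => ?_
    rw [hφx' j (Nat.lt_succ_iff.mp (Finset.mem_range.mp hj))]
  have h0x : φ 0 x = 0 := by rw [hφx 0 (Nat.zero_le _), hb0]; simp
  have h0x' : φ 0 x' = b' 0 := by rw [hφx' 0 (Nat.zero_le _)]; simp
  obtain ⟨h1, B, hB, hB'⟩ := exists_basis_fin_two (K := K) x x' (by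
      intro s t hst
      have h2 := congrArg (Subtype.val) hst
      rw [Submodule.coe_add, Submodule.coe_smul, Submodule.coe_smul, Submodule.coe_zero] at h2
      have h3 := congrArg (φ 0) h2
      have h4 := congrArg ψ h2
      simp only [map_add, map_smul, smul_eq_mul, map_zero, h0x, h0x', hψx, hψx'] at h3 h4
      refine ⟨by simpa using h4, ?_⟩
      simpa [hb0'] using h3) (by
      intro y
      refine ⟨ψ y, φ 0 y / b' 0, ?_⟩
      rw [← sub_eq_zero]
      set z := y - (ψ y • x + (φ 0 (y : W K n r) / (b' 0 : K)) • x') with hz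
      have hzv : (z : W K n r) = y - (ψ y • (x : W K n r) + (φ 0 y / (b' 0 : K)) • (x' : W K n r)) := rfl
      have hz0 : φ 0 z = 0 := by
        rw [hzv]
        simp only [map_sub, map_add, map_smul, smul_eq_mul, h0x, h0x']
        field_simp
        ring
      have hz1 : ψ z = 0 := by
        rw [hzv]
        simp only [map_sub, map_add, map_smul, smul_eq_mul, hψx, hψx']
        ring
      have hzG := (P.mem_goodKernel_iff hn _).mp z.2
      rw [hc, hM] at hzG
      apply Subtype.ext
      apply P.ext_coeff
      rw [hc, hM]
      -- Adding the equation `ψ z = 0` fills the gap at `k = 1`, so the columns are all of `[0, M -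
      -- 1]`.
      refine eq_zero_of_sum_mul_choose_sub_eq_zero (u := 1) (v := M - 1) le_rfl (by omega)
        (by omega) (by omega) le_rfl (fun j => φ j z) hz0 fun k hk => ?_
      rw [Finset.mem_union, Finset.mem_singleton, Finset.mem_Icc] at hk
      by_cases hk1 : k = 1
      · rw [hk1, ← hz1, hψ]
        simp only [Nat.choose_one_right]
      · exact hzG k ((hG k).mpr ⟨by omega, hk1⟩))
  refine ⟨h1, B, ?_, ?_⟩
  · rw [hB, hx]
    simp only [hM]
  · rw [hB', hx']
    simp only [hM]

/-- The case in which the coefficients are binomial determinants. -/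
lemma exists_basis_goodKernel_binomDet [CharZero K] (hn : 3 ≤ n) {M N u v : ℕ}
    (hM : l - (e + 1) / 2 = M) (hc : min (l - (e + 1) / 2) (e / 2) = N) (hu : 1 ≤ u)
    (huv : u ≤ v + 1) (hN : N + u = v + 2) (hv : v + 1 ≤ M) (hG : G n r = {0} ∪ Finset.Icc u v) :
    Module.finrank K (goodKernel K hn r) = 1 ∧
      ∃ B : Module.Basis (Fin 1) K (goodKernel K hn r),
        ((B 0 : W K n r) : MvPowerSeries (Fin 3) K) = altPoly K M (e % 2) (e / 2) N fun j =>
          binomDet (Finset.Icc (M - N) M \ {M - j}) ({0} ∪ Finset.Icc u v) := by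
  have hp : M - N + N = M := by omega
  refine P.exists_basis_goodKernel hn hM hc hu huv hN hv hG _ ?_ fun k hk => ?_
  · have h1 := binomDet_Icc_sdiff_last_ne_zero K (p := M - N) hu huv hN (by omega)
    rwa [hp] at h1
  · have h1 := sum_binomDet_mul_choose (p := M - N) (card_zero_union_Icc hu huv hN) hk
    rwa [hp] at h1

/-- The case in which the coefficients are binomial coefficients. -/
lemma exists_basis_goodKernel_choose [CharZero K] (hn : 3 ≤ n) {M : ℕ} (hM1 : 1 ≤ M)
    (hM : l - (e + 1) / 2 = M) (hc : min (l - (e + 1) / 2) (e / 2) = M)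
    (hG : G n r = {0} ∪ Finset.Icc 1 (M - 1)) :
    Module.finrank K (goodKernel K hn r) = 1 ∧
      ∃ B : Module.Basis (Fin 1) K (goodKernel K hn r),
        ((B 0 : W K n r) : MvPowerSeries (Fin 3) K) =
          altPoly K M (e % 2) (e / 2) M fun j => Nat.choose M (M - j) := by
  refine P.exists_basis_goodKernel hn hM hc le_rfl (by omega) (by omega) (by omega) hG _ (by simp)
    fun k hk => ?_
  rw [Finset.mem_union, Finset.mem_singleton, Finset.mem_Icc] at hk
  exact sum_neg_one_pow_mul_choose_mul_choose (by omega)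

end IsDegree

/-! ### The two parities of `n` -/

lemma isDegree_of_odd {m k : ℕ} (hm : 3 ≤ m) (hk : 1 ≤ k) (hkn : k ≤ 2 * m + 1) :
    IsDegree (2 * m + 1) (2 * m) m (k + 1) (r (2 * m + 1) k) := by
  have hq : q (2 * m + 1) = 2 * m + 1 := by unfold q; omega
  refine ⟨?_, hm, Or.inl ⟨hq, rfl⟩, by omega, by omega, ?_⟩
  · rw [hq, a, Nat.add_sub_cancel, mul_assoc, Nat.mul_div_cancel_left _ (by norm_num), mul_comm]
  · rw [r, s₀, Nat.add_sub_cancel]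
    omega

lemma isDegree_of_even {m k : ℕ} (hm : 3 ≤ m) (hk : 1 ≤ k) (hkn : k ≤ 2 * m - 1) :
    IsDegree (2 * m) (2 * m - 1) m (k + 1) (r (2 * m) k) := by
  have hq : q (2 * m) = 2 * m - 1 := by unfold q; omega
  refine ⟨?_, hm, Or.inr ⟨hq, rfl⟩, by omega, by omega, ?_⟩
  · rw [hq, a, mul_left_comm, Nat.mul_div_cancel_left _ (by norm_num)]
  · rw [r, s₀]
    omega

end GoodKernels

/-! ### The given polynomials in normal form -/

namespace GoodKernels

variable (K : Type*) [Field K]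

/-- Floors of `(k + 1)/2` and `(k + 2)/2` merge the formulas for odd and even `k`. -/
lemma g_odd_eq_binomDet {m k : ℕ} (hm : 3 ≤ m) (hkm : k ≤ 2 * m - 2) :
    g K (2 * m + 1) k = altPoly K (2 * m - (k + 2) / 2) ((k + 1) % 2) ((k + 1) / 2) ((k + 1) / 2)
      fun j => binomDet (Finset.Icc (2 * m - (k + 2) / 2 - (k + 1) / 2) (2 * m - (k + 2) / 2) \
        {2 * m - (k + 2) / 2 - j}) ({0} ∪ Finset.Icc ((2 * m + 2 - k) / 2) (m - 1)) := by
  rw [g, if_pos (odd_two_mul_add_one m), gOdd, if_pos (by omega), altPoly]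
  split_ifs with hkodd
  · rw [Nat.odd_iff] at hkodd
    refine Finset.sum_congr rfl fun j hj => ?_
    have := Finset.mem_range.mp hj
    rw [show 2 * m + 1 - k - 2 = 2 * m - (k + 2) / 2 - (k + 1) / 2 by omega,
      show (2 * (2 * m + 1) - k - 3) / 2 = 2 * m - (k + 2) / 2 by omega,
      show (2 * (2 * m + 1) - k - 3 - 2 * j) / 2 = 2 * m - (k + 2) / 2 - j by omega,
      show (2 * m + 1 - k) / 2 = (2 * m + 2 - k) / 2 by omega,
      show (2 * m + 1 - 3) / 2 = m - 1 by omega,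
      show (k + 1 - 2 * j) / 2 = (k + 1) / 2 - j by omega,
      show (k + 1) % 2 = 0 by omega, zero_add]
  · rw [Nat.not_odd_iff] at hkodd
    rw [show k / 2 = (k + 1) / 2 by omega]
    refine Finset.sum_congr rfl fun j hj => ?_
    have := Finset.mem_range.mp hj
    rw [show 2 * m + 1 - k - 2 = 2 * m - (k + 2) / 2 - (k + 1) / 2 by omega,
      show (2 * (2 * m + 1) - k - 4) / 2 = 2 * m - (k + 2) / 2 by omega,
      show (2 * (2 * m + 1) - k - 4 - 2 * j) / 2 = 2 * m - (k + 2) / 2 - j by omega,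
      show (2 * m + 1 - k + 1) / 2 = (2 * m + 2 - k) / 2 by omega,
      show (2 * m + 1 - 3) / 2 = m - 1 by omega,
      show (k - 2 * j) / 2 = (k + 1) / 2 - j by omega,
      show 1 + 2 * j = (k + 1) % 2 + 2 * j by omega]

lemma g_odd_eq_choose {m k : ℕ} (hm : 3 ≤ m) (hkm : 2 * m - 1 ≤ k) (hkm' : k ≤ 2 * m + 1) :
    g K (2 * m + 1) k = altPoly K (2 * m - (k + 2) / 2) ((k + 1) % 2) ((k + 1) / 2)
      (2 * m - (k + 2) / 2)
      fun j => Nat.choose (2 * m - (k + 2) / 2) (2 * m - (k + 2) / 2 - j) := by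
  rw [g, if_pos (odd_two_mul_add_one m), gOdd, if_neg (by omega), altPoly]
  split_ifs with h1 h2
  · rw [show (2 * m + 1 - 1) / 2 = 2 * m - (k + 2) / 2 by omega]
    refine Finset.sum_congr rfl fun j hj => ?_
    have := Finset.mem_range.mp hj
    congr 1 <;> try omega
    rw [show (2 * m + 1 - 1 - 2 * j) / 2 = 2 * m - (k + 2) / 2 - j by omega]
  · rw [show (2 * m + 1 - 3) / 2 = 2 * m - (k + 2) / 2 by omega]
    refine Finset.sum_congr rfl fun j hj => ?_
    have := Finset.mem_range.mp hj
    congr 1 <;> try omega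
    rw [show (2 * m + 1 - 3 - 2 * j) / 2 = 2 * m - (k + 2) / 2 - j by omega]
  · rw [show (2 * m + 1 - 3) / 2 = 2 * m - (k + 2) / 2 by omega]
    refine Finset.sum_congr rfl fun j hj => ?_
    have := Finset.mem_range.mp hj
    congr 1 <;> try omega
    rw [show (2 * m + 1 - 3 - 2 * j) / 2 = 2 * m - (k + 2) / 2 - j by omega]

lemma not_odd_two_mul (m : ℕ) : ¬ Odd (2 * m) :=
  Nat.not_odd_iff_even.mpr (even_two_mul m)

/-- The separately defined case `k = n - 3` fits the same pattern, with `M = m`, `N = m - 1` and `u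
= 2`. -/
lemma g_even_eq_binomDet {m k : ℕ} (hm : 3 ≤ m) (hkm : k ≤ 2 * m - 3) :
    g K (2 * m) k =
      altPoly K (2 * m - 1 - (k + 2) / 2) ((k + 1) % 2) ((k + 1) / 2) ((k + 1) / 2)
      fun j => binomDet (Finset.Icc (2 * m - 1 - (k + 2) / 2 - (k + 1) / 2)
        (2 * m - 1 - (k + 2) / 2) \ {2 * m - 1 - (k + 2) / 2 - j})
        ({0} ∪ Finset.Icc ((2 * m + 2 - k) / 2) (m - 1)) := by
  rw [g, if_neg (not_odd_two_mul m), gEven, altPoly]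
  split_ifs with h1 hkodd h3
  · rw [Nat.odd_iff] at hkodd
    refine Finset.sum_congr rfl fun j hj => ?_
    have := Finset.mem_range.mp hj
    rw [show 2 * m - k - 2 = 2 * m - 1 - (k + 2) / 2 - (k + 1) / 2 by omega,
      show (2 * (2 * m) - k - 3) / 2 = 2 * m - 1 - (k + 2) / 2 by omega,
      show (2 * (2 * m) - k - 3 - 2 * j) / 2 = 2 * m - 1 - (k + 2) / 2 - j by omega,
      show (2 * m - k + 1) / 2 = (2 * m + 2 - k) / 2 by omega,
      show (2 * m - 2) / 2 = m - 1 by omega,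
      show (k + 1 - 2 * j) / 2 = (k + 1) / 2 - j by omega,
      show (k + 1) % 2 = 0 by omega, zero_add]
  · rw [Nat.not_odd_iff] at hkodd
    rw [show k / 2 = (k + 1) / 2 by omega]
    refine Finset.sum_congr rfl fun j hj => ?_
    have := Finset.mem_range.mp hj
    rw [show 2 * m - k - 2 = 2 * m - 1 - (k + 2) / 2 - (k + 1) / 2 by omega,
      show (2 * (2 * m) - k - 4) / 2 = 2 * m - 1 - (k + 2) / 2 by omega,
      show (2 * (2 * m) - k - 4 - 2 * j) / 2 = 2 * m - 1 - (k + 2) / 2 - j by omega,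
      show (2 * m - k + 2) / 2 = (2 * m + 2 - k) / 2 by omega,
      show (2 * m - 2) / 2 = m - 1 by omega,
      show (k - 2 * j) / 2 = (k + 1) / 2 - j by omega,
      show 1 + 2 * j = (k + 1) % 2 + 2 * j by omega]
  · rw [show (2 * m - 2) / 2 = (k + 1) / 2 by omega]
    refine Finset.sum_congr rfl fun j hj => ?_
    have := Finset.mem_range.mp hj
    rw [show 2 * m - 1 - (k + 2) / 2 - (k + 1) / 2 = 1 by omega,
      show 2 * m / 2 = 2 * m - 1 - (k + 2) / 2 by omega,
      show (2 * m - 2 * j) / 2 = 2 * m - 1 - (k + 2) / 2 - j by omega,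
      show (2 * m + 2 - k) / 2 = 2 by omega,
      show (k + 1) / 2 = m - 1 by omega,
      show (2 * m - 2 - 2 * j) / 2 = m - 1 - j by omega,
      show (k + 1) % 2 = 0 by omega, zero_add]
  all_goals omega

lemma g_even_pred {m : ℕ} (hm : 3 ≤ m) :
    g K (2 * m) (2 * m - 1) = altPoly K (m - 1) 1 (m - 1) (m - 1)
      fun j => Nat.choose (m - 1) (m - 1 - j) := by
  rw [g, if_neg (not_odd_two_mul m), gEven, if_neg (by omega), if_neg (by omega),
    if_neg (by omega), if_pos rfl, altPoly, show (2 * m - 2) / 2 = m - 1 by omega]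
  refine Finset.sum_congr rfl fun j _ => ?_
  rw [show (2 * m - 2 - 2 * j) / 2 = m - 1 - j by omega]

lemma g_even_self {m : ℕ} (hm : 3 ≤ m) :
    g K (2 * m) (2 * m) = altPoly K (m - 1) 0 m (m - 1)
      fun j => Nat.choose (m - 1) (m - 1 - j) := by
  rw [g, if_neg (not_odd_two_mul m), gEven, if_neg (by omega), if_neg (by omega),
    if_neg (by omega), if_neg (by omega), altPoly, show (2 * m - 2) / 2 = m - 1 by omega]
  refine Finset.sum_congr rfl fun j _ => ?_
  rw [show (2 * m - 2 - 2 * j) / 2 = m - 1 - j by omega,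
    show (2 * m - 2 * j) / 2 = m - j by omega, zero_add]

/-- The polynomial is `y^(n-3)(xz - y²)`, the last two terms of the string; `(-1)^m` cancels the
sign built into `altPoly`. -/
lemma g_even_sub_two {m : ℕ} (hm : 3 ≤ m) :
    g K (2 * m) (2 * m - 2) = altPoly K (m - 1) 1 (m - 1) (m - 1)
      fun j => if j < m - 2 then 0 else (-1) ^ m := by
  obtain ⟨s, rfl⟩ : ∃ s, m = s + 3 := ⟨m - 3, by omega⟩
  rw [g, if_neg (not_odd_two_mul _), gEven, if_neg (by omega), if_neg (by omega),
    if_pos rfl, altPoly, show s + 3 - 1 + 1 = s + 1 + 1 + 1 by omega, Finset.sum_range_succ,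
    Finset.sum_range_succ, Finset.sum_eq_zero, if_neg (by omega), if_neg (by omega)]
  · have h1 : ((-1 : ℤ)) ^ (s + 1) * (-1) ^ (s + 3) = 1 := by
      rw [← pow_add]
      exact Even.neg_one_pow ⟨s + 2, by ring⟩
    have h2 : ((-1 : ℤ)) ^ (s + 1 + 1) * (-1) ^ (s + 3) = -1 := by
      rw [← pow_add]
      exact Odd.neg_one_pow ⟨s + 2, by ring⟩
    rw [term, term, h1, h2, show s + 3 - 1 - (s + 1) = 1 by omega,
      show s + 3 - 1 - (s + 1 + 1) = 0 by omega, show 2 * (s + 3) - 3 = 1 + 2 * (s + 1) by omega,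
      show 2 * (s + 3) - 1 = 1 + 2 * (s + 1 + 1) by omega]
    simp
    ring
  · intro j hj
    have := Finset.mem_range.mp hj
    rw [if_pos (by omega), term]
    simp

/-- With `F j = (m-1-j choose k)` the value is `(1 choose k) - (0 choose k)`, nonzero only for `k =
1`: the image of `y^(n-3)(xz - y²)` is the single power `t^(r+q)`. -/
lemma sum_alternating_tail {m : ℕ} (hm : 3 ≤ m) (F : ℕ → ℤ) :
    ∑ j ∈ Finset.range (m - 1 + 1), (-1) ^ j * (if j < m - 2 then 0 else (-1) ^ m) * F j =
      F (m - 2) - F (m - 1) := by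
  obtain ⟨s, rfl⟩ : ∃ s, m = s + 3 := ⟨m - 3, by omega⟩
  rw [show s + 3 - 1 + 1 = s + 1 + 1 + 1 by omega, Finset.sum_range_succ,
    Finset.sum_range_succ, Finset.sum_eq_zero, if_neg (by omega), if_neg (by omega)]
  · have h1 : ((-1 : ℤ)) ^ (s + 1) * (-1) ^ (s + 3) = 1 := by
      rw [← pow_add]
      exact Even.neg_one_pow ⟨s + 2, by ring⟩
    have h2 : ((-1 : ℤ)) ^ (s + 1 + 1) * (-1) ^ (s + 3) = -1 := by
      rw [← pow_add]
      exact Odd.neg_one_pow ⟨s + 2, by ring⟩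
    rw [h1, h2, show s + 3 - 2 = s + 1 by omega, show s + 3 - 1 = s + 1 + 1 by omega]
    ring
  · intro j hj
    have := Finset.mem_range.mp hj
    rw [if_pos (by omega)]
    simp

/-! ### Assembling the cases -/

variable [CharZero K]

lemma exists_basis_goodKernel_odd {m k : ℕ} (hm : 3 ≤ m) (hn : 3 ≤ 2 * m + 1) (hk : 1 ≤ k)
    (hkn : k ≤ 2 * m + 1) :
    Module.finrank K (goodKernel K hn (r (2 * m + 1) k)) = 1 ∧
      ∃ b : Module.Basis (Fin 1) K (goodKernel K hn (r (2 * m + 1) k)),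
        ((b 0 : W K (2 * m + 1) (r (2 * m + 1) k)) : MvPowerSeries (Fin 3) K) =
          (g K (2 * m + 1) k : MvPowerSeries (Fin 3) K) := by
  have P := isDegree_of_odd hm hk hkn
  have hq : q (2 * m + 1) = 2 * m + 1 := by unfold q; omega
  rcases le_or_gt k (2 * m - 2) with hkm | hkm
  · rw [g_odd_eq_binomDet K hm hkm]
    refine P.exists_basis_goodKernel_binomDet hn rfl (by omega) (by omega) (by omega) (by omega)
      (by omega) ?_
    ext i
    rw [P.mem_G_iff, hq, Finset.mem_union, Finset.mem_singleton, Finset.mem_Icc]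
    split_ifs <;> omega
  · rw [g_odd_eq_choose K hm (by omega) hkn]
    refine P.exists_basis_goodKernel_choose hn (by omega) rfl (by omega) ?_
    ext i
    rw [P.mem_G_iff, hq, Finset.mem_union, Finset.mem_singleton, Finset.mem_Icc]
    split_ifs <;> omega

lemma exists_basis_goodKernel_even {m k : ℕ} (hm : 3 ≤ m) (hn : 3 ≤ 2 * m) (hk : 1 ≤ k)
    (hkn : k ≤ 2 * m - 3) :
    Module.finrank K (goodKernel K hn (r (2 * m) k)) = 1 ∧
      ∃ b : Module.Basis (Fin 1) K (goodKernel K hn (r (2 * m) k)),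
        ((b 0 : W K (2 * m) (r (2 * m) k)) : MvPowerSeries (Fin 3) K) =
          (g K (2 * m) k : MvPowerSeries (Fin 3) K) := by
  have P := isDegree_of_even hm hk (by omega)
  have hq : q (2 * m) = 2 * m - 1 := by unfold q; omega
  rw [g_even_eq_binomDet K hm hkn]
  refine P.exists_basis_goodKernel_binomDet hn rfl (by omega) (by omega) (by omega) (by omega)
    (by omega) ?_
  ext i
  rw [P.mem_G_iff, hq, Finset.mem_union, Finset.mem_singleton, Finset.mem_Icc]
  split_ifs <;> omega

/-- The index shifts by one because `g_{n-2}` and `g_{n-1}` share the degree `r_{n-2}`, so `g_n` has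
degree `r_{n-1}`. Here `e = q + 1`, and the string stops when `x`, not `z`, is exhausted. -/
lemma exists_basis_goodKernel_even_pred {m : ℕ} (hm : 3 ≤ m) (hn : 3 ≤ 2 * m) :
    Module.finrank K (goodKernel K hn (r (2 * m) (2 * m - 1))) = 1 ∧
      ∃ b : Module.Basis (Fin 1) K (goodKernel K hn (r (2 * m) (2 * m - 1))),
        ((b 0 : W K (2 * m) (r (2 * m) (2 * m - 1))) : MvPowerSeries (Fin 3) K) =
          (g K (2 * m) (2 * m) : MvPowerSeries (Fin 3) K) := by
  have P := isDegree_of_even (k := 2 * m - 1) hm (by omega) (by omega)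
  have hq : q (2 * m) = 2 * m - 1 := by unfold q; omega
  rw [g_even_self K hm]
  have h1 := P.exists_basis_goodKernel_choose (K := K) hn (M := m - 1) (by omega) (by omega)
    (by omega) (by
      ext i
      rw [P.mem_G_iff, hq, Finset.mem_union, Finset.mem_singleton, Finset.mem_Icc]
      split_ifs <;> omega)
  rwa [show (2 * m - 1 + 1) % 2 = 0 by omega, show (2 * m - 1 + 1) / 2 = m by omega] at h1

lemma exists_basis_goodKernel_even_sub_two {m : ℕ} (hm : 3 ≤ m) (hn : 3 ≤ 2 * m) :
    Module.finrank K (goodKernel K hn (r (2 * m) (2 * m - 2))) = 2 ∧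
      ∃ b : Module.Basis (Fin 2) K (goodKernel K hn (r (2 * m) (2 * m - 2))),
        ((b 0 : W K (2 * m) (r (2 * m) (2 * m - 2))) : MvPowerSeries (Fin 3) K) =
          (g K (2 * m) (2 * m - 2) : MvPowerSeries (Fin 3) K) ∧
        ((b 1 : W K (2 * m) (r (2 * m) (2 * m - 2))) : MvPowerSeries (Fin 3) K) =
          (g K (2 * m) (2 * m - 1) : MvPowerSeries (Fin 3) K) := by
  have P := isDegree_of_even (k := 2 * m - 2) hm (by omega) (by omega)
  have hq : q (2 * m) = 2 * m - 1 := by unfold q; omega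
  rw [g_even_sub_two K hm, g_even_pred K hm]
  have h1 := P.exists_basis_goodKernel_two (K := K) hn (M := m - 1) (by omega) (by omega)
    (by omega) (by
      intro i
      rw [P.mem_G_iff, hq]
      split_ifs <;> omega)
    (fun j => if j < m - 2 then 0 else (-1) ^ m) (fun j => Nat.choose (m - 1) (m - 1 - j))
    (if_pos (by omega)) (by simp)
    (by
      rw [sum_alternating_tail hm (fun j => ((m - 1 - j : ℕ) : ℤ)),
        show m - 1 - (m - 2) = 1 by omega, Nat.sub_self]
      rfl)
    (by
      have h2 := sum_neg_one_pow_mul_choose_mul_choose (N := m - 1) (k := 1) (by omega)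
      simpa only [Nat.choose_one_right] using h2)
    (by
      intro k _ hk1
      rw [sum_alternating_tail hm (fun j => (Nat.choose (m - 1 - j) k : ℤ)),
        show m - 1 - (m - 2) = 1 by omega, Nat.sub_self]
      rcases Nat.eq_zero_or_pos k with rfl | hk
      · simp
      · rw [Nat.choose_eq_zero_of_lt (by omega), Nat.choose_eq_zero_of_lt hk]
        rfl)
    (fun k hk _ => sum_neg_one_pow_mul_choose_mul_choose hk)
  rwa [show (2 * m - 2 + 1) % 2 = 1 by omega, show (2 * m - 2 + 1) / 2 = m - 1 by omega] at h1

end GoodKernels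

theorem mainTheorem2 (K : Type*) [Field K] [CharZero K] (n : ℕ) (hn : 6 ≤ n) :
    (Odd n →
      ∀ k, 1 ≤ k → k ≤ n →
        Module.finrank K (GoodKernels.goodKernel K (le_trans (by norm_num) hn : 3 ≤ n)
          (GoodKernels.r n k)) = 1 ∧
        ∃ b : Module.Basis (Fin 1) K
            (GoodKernels.goodKernel K (le_trans (by norm_num) hn : 3 ≤ n) (GoodKernels.r n k)),
          ((b 0 : GoodKernels.W K n (GoodKernels.r n k)) : MvPowerSeries (Fin 3) K) =
            (GoodKernels.g K n k : MvPowerSeries (Fin 3) K)) ∧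
    (Even n →
      (∀ k, 1 ≤ k → k ≤ n - 3 →
        Module.finrank K (GoodKernels.goodKernel K (le_trans (by norm_num) hn : 3 ≤ n)
          (GoodKernels.r n k)) = 1 ∧
        ∃ b : Module.Basis (Fin 1) K
            (GoodKernels.goodKernel K (le_trans (by norm_num) hn : 3 ≤ n) (GoodKernels.r n k)),
          ((b 0 : GoodKernels.W K n (GoodKernels.r n k)) : MvPowerSeries (Fin 3) K) =
            (GoodKernels.g K n k : MvPowerSeries (Fin 3) K)) ∧
      (Module.finrank K (GoodKernels.goodKernel K (le_trans (by norm_num) hn : 3 ≤ n)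
          (GoodKernels.r n (n - 2))) = 2 ∧
        ∃ b : Module.Basis (Fin 2) K
            (GoodKernels.goodKernel K (le_trans (by norm_num) hn : 3 ≤ n)
              (GoodKernels.r n (n - 2))),
          ((b 0 : GoodKernels.W K n (GoodKernels.r n (n - 2))) : MvPowerSeries (Fin 3) K) =
            (GoodKernels.g K n (n - 2) : MvPowerSeries (Fin 3) K) ∧
          ((b 1 : GoodKernels.W K n (GoodKernels.r n (n - 2))) : MvPowerSeries (Fin 3) K) =
            (GoodKernels.g K n (n - 1) : MvPowerSeries (Fin 3) K)) ∧
      (Module.finrank K (GoodKernels.goodKernel K (le_trans (by norm_num) hn : 3 ≤ n)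
          (GoodKernels.r n (n - 1))) = 1 ∧
        ∃ b : Module.Basis (Fin 1) K
            (GoodKernels.goodKernel K (le_trans (by norm_num) hn : 3 ≤ n)
              (GoodKernels.r n (n - 1))),
          ((b 0 : GoodKernels.W K n (GoodKernels.r n (n - 1))) : MvPowerSeries (Fin 3) K) =
            (GoodKernels.g K n n : MvPowerSeries (Fin 3) K))) := by
  constructor
  · rintro ⟨m, rfl⟩ k hk hkn
    exact GoodKernels.exists_basis_goodKernel_odd K (by omega) _ hk hkn
  · intro h
    obtain ⟨m, rfl⟩ := even_iff_exists_two_mul.mp h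
    exact ⟨fun k hk hkn => GoodKernels.exists_basis_goodKernel_even K (by omega) _ hk hkn,
      GoodKernels.exists_basis_goodKernel_even_sub_two K (by omega) _,
      GoodKernels.exists_basis_goodKernel_even_pred K (by omega) _⟩
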